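/- Let $k$ be a field, let $A$ and $B$ be finite dimensional $k$-algebras, and write $\otimes=\otimes_k$. Modules are finitely generated left modules. Assume that $A$ and $B$ are Gorenstein, i.e. each of them has finite injective dimension as a left and as a right module over itself, and that $k$ is a splitting field for $A$ or for $B$, i.e. every simple module over that algebra has endomorphism algebra $k$. For a finite dimensional algebra $\Gamma$, a $\Gamma$-module $G$ is called Gorenstein projective if there is an exact complex $P^\bullet=(\cdots\to P^i\xrightarrow{d^i}P^{i+1}\xrightarrow{d^{i+1}}P^{i+2}\to\cdots)$, $i\in\mathbb Z$, of finitely generated projective $\Gamma$-modules such that $\operatorname{Hom}_\Gamma(P^\bullet,\Gamma)$ is exact and $G\cong\operatorname{Ker} d^1$; the class of these modules is denoted by $\Gamma\text{-}\mathsf{Gproj}$. For a class $\mathscr X$ of $\Gamma$-modules closed under isomorphism, $\mathsf{addfilt}(\mathscr X)$ is the class of all direct summands of $\Gamma$-modules $M$ that have a finite filtration $0=M_0\subseteq M_1\subseteq\cdots\subseteq M_m=M$ by submodules with $M_i/M_{i-1}\in\mathscr X$ for $1\le i\le m$. Then $$(A\otimes B)\text{-}\mathsf{Gproj}=\mathsf{addfilt}\bigl(A\text{-}\mathsf{Gproj}\otimes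 B\text{-}\mathsf{Gproj}\bigr),$$ where $A\text{-}\mathsf{Gproj}\otimes B\text{-}\mathsf{Gproj}$ is the class of all $A\otimes B$-modules isomorphic to $X\otimes Y$ with $X\in A\text{-}\mathsf{Gproj}$ and $Y\in B\text{-}\mathsf{Gproj}$, with action $(a\otimes b)(x\otimes y)=ax\otimes by$. -/

import Mathlib

open CategoryTheory
open scoped TensorProduct

/-- The ring `R` has finite injective dimension as a left and as a right module over itself.
Right `R`-modules are modules over `Rᵐᵒᵖ`. A finite dimensional algebra with this property is a
Gorenstein algebra. -/
def IsGorensteinAlgebra.{v} (R : Type v) [Ring R] : Prop :=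
  injectiveDimension (ModuleCat.of.{v} R R) ≠ ⊤ ∧
    injectiveDimension (ModuleCat.of.{v} Rᵐᵒᵖ R) ≠ ⊤

/-- `k` is a splitting field for the `k`-algebra `A`: every simple `A`-module has endomorphism
algebra `k`, that is, the structure map `k → End_A(S)` is bijective. -/
def IsSplittingFieldFor.{t, v} (k : Type t) (A : Type v) [Field k] [Ring A] [Algebra k A] : Prop :=
  ∀ (S : Type v) [AddCommGroup S] [Module k S] [Module A S] [IsScalarTower k A S]
    [IsSimpleModule A S], Function.Bijective (algebraMap k (Module.End A S))

/-- A complete projective resolution of the left `R`-module `G`: an exact sequence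
`⋯ → P⁰ → P¹ → P² → ⋯` of finitely generated projective left `R`-modules which stays exact under
`Hom_R(-, R)`, together with an isomorphism of `G` with the kernel of `d¹ : P¹ → P²`. Exactness
of `(P, d)`, respectively of `Hom_R(P, R)`, includes that it is a complex. -/
structure CompleteProjectiveResolution.{v, w} (R : Type v) [Ring R] (G : ModuleCat.{w} R) where
  P : ℤ → ModuleCat.{w} R
  d : ∀ i : ℤ, P i →ₗ[R] P (i + 1)
  finite : ∀ i, Module.Finite R (P i)
  projective : ∀ i, Module.Projective R (P i)
  exact : ∀ i, Function.Exact (d i) (d (i + 1))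
  hom_exact : ∀ i, Function.Exact
    (fun φ : P (i + 1 + 1) →ₗ[R] R => φ ∘ₗ d (i + 1))
    (fun φ : P (i + 1) →ₗ[R] R => φ ∘ₗ d i)
  iso : G ≃ₗ[R] LinearMap.ker (d 1)

/-- The class of (finitely generated) Gorenstein projective left `R`-modules. Finite generation is
automatic, as `ker d¹` is the image of `P⁰`. -/
def gorensteinProjective.{v, w} (R : Type v) [Ring R] : ObjectProperty (ModuleCat.{w} R) :=
  fun G => Nonempty (CompleteProjectiveResolution R G)

/-- `filt(𝒳)`: the modules `M` with a finite filtration `0 = F₀ ⊆ F₁ ⊆ ⋯ ⊆ Fₘ = M` by submodules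
all of whose factors `Fᵢ₊₁ / Fᵢ` lie in `𝒳`. -/
def filt.{v, w} {R : Type v} [Ring R] (𝒳 : ObjectProperty (ModuleCat.{w} R)) :
    ObjectProperty (ModuleCat.{w} R) :=
  fun M => ∃ (m : ℕ) (F : Fin (m + 1) → Submodule R M),
    F 0 = ⊥ ∧ F (Fin.last m) = ⊤ ∧
      ∀ i : Fin m, F i.castSucc ≤ F i.succ ∧
        𝒳 (ModuleCat.of R (F i.succ ⧸ (F i.castSucc).submoduleOf (F i.succ)))

/-- `add filt(𝒳)`: the direct summands of the modules in `filt(𝒳)`. -/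
def addFilt.{v, w} {R : Type v} [Ring R] (𝒳 : ObjectProperty (ModuleCat.{w} R)) :
    ObjectProperty (ModuleCat.{w} R) :=
  fun M => ∃ N M' : ModuleCat.{w} R, filt 𝒳 N ∧ Nonempty (N ≃ₗ[R] M × M')

/-- The `A ⊗ B`-module structure on `X ⊗ Y`, given by `(a ⊗ b) • (x ⊗ y) = (a • x) ⊗ (b • y)`. -/
@[reducible]
noncomputable def tensorModule.{t, v, w, x, y} (k : Type t) (A : Type v) (B : Type w) [Field k]
    [Ring A] [Algebra k A] [Ring B] [Algebra k B] (X : Type x) (Y : Type y)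
    [AddCommGroup X] [Module k X] [Module A X] [IsScalarTower k A X]
    [AddCommGroup Y] [Module k Y] [Module B Y] [IsScalarTower k B Y] :
    Module (A ⊗[k] B) (X ⊗[k] Y) :=
  Module.compHom (X ⊗[k] Y)
    ((Module.endTensorEndAlgHom (R := k) (S := k) (A := k) (M := X) (N := Y)).comp
      (Algebra.TensorProduct.map (Algebra.lsmul k k X : A →ₐ[k] Module.End k X)
        (Algebra.lsmul k k Y : B →ₐ[k] Module.End k Y))).toRingHom

theorem tensorModule_smul_tmul.{t, v, w, x, y} {k : Type t} {A : Type v} {B : Type w} [Field k]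
    [Ring A] [Algebra k A] [Ring B] [Algebra k B] {X : Type x} {Y : Type y}
    [AddCommGroup X] [Module k X] [Module A X] [IsScalarTower k A X]
    [AddCommGroup Y] [Module k Y] [Module B Y] [IsScalarTower k B Y]
    (a : A) (b : B) (p : X) (q : Y) :
    letI := tensorModule k A B X Y
    (a ⊗ₜ[k] b : A ⊗[k] B) • (p ⊗ₜ[k] q : X ⊗[k] Y) = (a • p) ⊗ₜ[k] (b • q) :=
  rfl

section

open scoped ModuleCat

/-- The `A ⊗ B`-module `X ⊗ Y` for an `A`-module `X` and a `B`-module `Y`, where `k` acts on `X`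
and `Y` through `A` and `B`. -/
noncomputable def tensorObj.{t, v, w} (k : Type t) {A : Type v} {B : Type w} [Field k]
    [Ring A] [Algebra k A] [Ring B] [Algebra k B] (X : ModuleCat.{v} A) (Y : ModuleCat.{w} B) :
    ModuleCat.{max v w} (A ⊗[k] B) :=
  letI := tensorModule k A B X Y
  ModuleCat.of (A ⊗[k] B) (X ⊗[k] Y)

end

/-- `𝒳 ⊗ 𝒴`: the `A ⊗ B`-modules (isomorphic to one) of the form `X ⊗ Y` with `X` in `𝒳` and `Y`
in `𝒴`. -/
def tensorClass.{t, v, w} (k : Type t) {A : Type v} {B : Type w} [Field k]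
    [Ring A] [Algebra k A] [Ring B] [Algebra k B]
    (𝒳 : ObjectProperty (ModuleCat.{v} A)) (𝒴 : ObjectProperty (ModuleCat.{w} B)) :
    ObjectProperty (ModuleCat.{max v w} (A ⊗[k] B)) :=
  fun M => ∃ (X : ModuleCat.{v} A) (Y : ModuleCat.{w} B),
    𝒳 X ∧ 𝒴 Y ∧ Nonempty (M ≅ tensorObj k X Y)

universe t v w

-- Write 𝒲 for the modules with a finite filtration whose factors are X ⊗ Y with X, Y Gorenstein
-- projective. Both inclusions rest on one observation: if P → X and Q → Y are projective
-- presentations with kernels K and K', then P ⊗ Q → X ⊗ Y factors through X ⊗ Q, so its kernel is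
-- an extension of X ⊗ K' by K ⊗ Q; factoring through P ⊗ Y gives an extension of K ⊗ Y by P ⊗ K'
-- instead. The dual holds for cokernels.
--
-- From right to left: a class of modules is Gorenstein projective as soon as all its members have
-- vanishing Ext¹ into the ring and have presentations and copresentations inside the class
-- (`le_gorensteinProjective`). The observation gives (co)presentations inside 𝒲, and Ext¹ vanishes
-- because every linear form on X ⊗ Y is a sum of tensor products of forms
-- (`exists_eq_sum_tensorObjForm`). Direct summands are handled by the same principle.
--
-- From left to right: some fixed n works for all finitely generated A ⊗ B-modules L, in the sense
-- that an n-th syzygy of L lies in 𝒲. A nonzero L contains S ⊗ Hom_A(S, L) for a simple A-submodule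
-- S, where End(S) = k makes evaluation injective
-- (`exists_injective_tensor_of_isSplittingFieldFor`), so L is filtered by modules X ⊗ Y, and by the
-- horseshoe lemma it suffices to treat these. Over a Gorenstein algebra high syzygies have no
-- higher Ext into the algebra, hence are Gorenstein projective
-- (`extBoundedClass_zero_le_gorensteinProjective`), and the observation combines the bounds for A
-- and B (`hasSyzygy_tensorObj`). Finally a Gorenstein projective M is an n-th syzygy of its n-th
-- cosyzygy, so by Schanuel's lemma M becomes a member of 𝒲 after adding a projective module
-- (`exists_prod_of_gorensteinProjective`).

universe u

/-- `0 → L → M → N → 0` is a short exact sequence. -/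
structure IsShortExact {R : Type*} [Ring R] {L M N : Type*} [AddCommGroup L] [Module R L]
    [AddCommGroup M] [Module R M] [AddCommGroup N] [Module R N]
    (f : L →ₗ[R] M) (g : M →ₗ[R] N) : Prop where
  injective : Function.Injective f
  exact : Function.Exact f g
  surjective : Function.Surjective g

/-! ### Short exact sequences: composites, horseshoe and Schanuel lemmas. -/

section Lifting

variable {R : Type*} [Ring R] {K L M N P Q : Type*}
  [AddCommGroup K] [Module R K] [AddCommGroup L] [Module R L]
  [AddCommGroup M] [Module R M] [AddCommGroup N] [Module R N]
  [AddCommGroup P] [Module R P] [AddCommGroup Q] [Module R Q]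

theorem LinearMap.exists_comp_eq_of_injective {f : L →ₗ[R] M} (hf : Function.Injective f)
    (φ : N →ₗ[R] M) (h : ∀ x, ∃ y, f y = φ x) : ∃ ψ : N →ₗ[R] L, f ∘ₗ ψ = φ := by
  choose ψ hψ using h
  refine ⟨⟨⟨ψ, fun x y => hf ?_⟩, fun r x => hf ?_⟩, LinearMap.ext hψ⟩
  · simp [hψ]
  · simp [hψ]

theorem LinearMap.exists_comp_eq_of_surjective {g : M →ₗ[R] N} (hg : Function.Surjective g)
    (φ : M →ₗ[R] L) (h : ∀ x, g x = 0 → φ x = 0) : ∃ ψ : N →ₗ[R] L, ψ ∘ₗ g = φ := by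
  have h' : ∀ x y, g x = g y → φ x = φ y := fun x y hxy => by
    rw [← sub_eq_zero, ← map_sub]
    exact h _ (by simp [hxy])
  obtain ⟨s, hs⟩ := hg.hasRightInverse
  have key : ∀ x, φ (s (g x)) = φ x := fun x => h' _ _ (hs _)
  refine ⟨⟨⟨fun y => φ (s y), fun x y => ?_⟩, fun r x => ?_⟩, LinearMap.ext key⟩
  · rw [← map_add]; exact h' _ _ (by simp [hs _])
  · simp only [RingHom.id_apply]; rw [← map_smul]; exact h' _ _ (by simp [hs _])

theorem IsShortExact.exists_lift {f : L →ₗ[R] M} {g : M →ₗ[R] N} (h : IsShortExact f g)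
    (φ : P →ₗ[R] M) (hφ : ∀ x, g (φ x) = 0) : ∃ ψ : P →ₗ[R] L, f ∘ₗ ψ = φ :=
  LinearMap.exists_comp_eq_of_injective h.injective φ fun x => (h.exact _).1 (hφ x)

theorem IsShortExact.exists_desc {f : L →ₗ[R] M} {g : M →ₗ[R] N} (h : IsShortExact f g)
    (φ : M →ₗ[R] P) (hφ : ∀ x, φ (f x) = 0) : ∃ ψ : N →ₗ[R] P, ψ ∘ₗ g = φ :=
  LinearMap.exists_comp_eq_of_surjective h.surjective φ fun x hx => by
    obtain ⟨y, rfl⟩ := (h.exact _).1 hx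
    exact hφ y

theorem IsShortExact.apply_apply {f : L →ₗ[R] M} {g : M →ₗ[R] N} (h : IsShortExact f g) (x : L) :
    g (f x) = 0 :=
  h.exact.apply_apply_eq_zero x

theorem isShortExact_ker {g : M →ₗ[R] N} (hg : Function.Surjective g) :
    IsShortExact (LinearMap.ker g).subtype g :=
  ⟨Subtype.val_injective, fun x => by simp, hg⟩

theorem isShortExact_mkQ_range {f : L →ₗ[R] M} (hf : Function.Injective f) :
    IsShortExact f (LinearMap.range f).mkQ :=
  ⟨hf, fun x => by simp, Submodule.mkQ_surjective _⟩

theorem IsShortExact.prodMap {L' M' N' : Type*} [AddCommGroup L'] [Module R L']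
    [AddCommGroup M'] [Module R M'] [AddCommGroup N'] [Module R N']
    {f : L →ₗ[R] M} {g : M →ₗ[R] N} (h : IsShortExact f g)
    {f' : L' →ₗ[R] M'} {g' : M' →ₗ[R] N'} (h' : IsShortExact f' g') :
    IsShortExact (f.prodMap f') (g.prodMap g') := by
  refine ⟨h.injective.prodMap h'.injective, fun x => ?_, h.surjective.prodMap h'.surjective⟩
  have h1 := h.exact x.1
  have h2 := h'.exact x.2
  simp only [Set.mem_range] at h1 h2
  simp [Prod.ext_iff, h1, h2]

theorem isShortExact_inl_snd : IsShortExact (LinearMap.inl R L M) (LinearMap.snd R L M) :=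
  ⟨LinearMap.inl_injective, Function.Exact.inl_snd, LinearMap.snd_surjective⟩

theorem isShortExact_equiv_left (e : L ≃ₗ[R] M) [Subsingleton N] :
    IsShortExact (e : L →ₗ[R] M) (0 : M →ₗ[R] N) :=
  ⟨e.injective, fun x => by simp, fun x => ⟨0, Subsingleton.elim _ _⟩⟩

theorem isShortExact_equiv_right [Subsingleton L] (e : M ≃ₗ[R] N) :
    IsShortExact (0 : L →ₗ[R] M) (e : M →ₗ[R] N) :=
  ⟨Function.injective_of_subsingleton _, fun x => by simp [eq_comm (a := x)], e.surjective⟩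

/-- The kernel of a composite of surjections is an extension of the two kernels. -/
theorem IsShortExact.exists_ker_comp {f₁ : K →ₗ[R] M} {g₁ : M →ₗ[R] N} (h₁ : IsShortExact f₁ g₁)
    {f₂ : L →ₗ[R] N} {g₂ : N →ₗ[R] P} (h₂ : IsShortExact f₂ g₂) :
    ∃ (i : K →ₗ[R] LinearMap.ker (g₂ ∘ₗ g₁)) (p : LinearMap.ker (g₂ ∘ₗ g₁) →ₗ[R] L),
      IsShortExact i p ∧ (LinearMap.ker (g₂ ∘ₗ g₁)).subtype ∘ₗ i = f₁ ∧
        f₂ ∘ₗ p = g₁ ∘ₗ (LinearMap.ker (g₂ ∘ₗ g₁)).subtype := by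
  obtain ⟨p, hp⟩ := h₂.exists_lift (g₁ ∘ₗ (LinearMap.ker (g₂ ∘ₗ g₁)).subtype) fun x => x.2
  have hp' : ∀ x, f₂ (p x) = g₁ x.1 := fun x => LinearMap.congr_fun hp x
  refine ⟨f₁.codRestrict _ fun x => by simp [h₁.apply_apply], p, ⟨?_, ?_, ?_⟩, rfl, hp⟩
  · intro x y hxy
    exact h₁.injective (congrArg Subtype.val hxy)
  · intro x
    rw [← h₂.injective.eq_iff, hp', map_zero, h₁.exact]
    simp [Subtype.ext_iff]
  · intro y
    obtain ⟨x, hx⟩ := h₁.surjective (f₂ y)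
    exact ⟨⟨x, by simp [hx, h₂.apply_apply]⟩, h₂.injective (by rw [hp', hx])⟩

/-- The cokernel of a composite of injections is an extension of the two cokernels. -/
theorem IsShortExact.exists_coker_comp {f₁ : K →ₗ[R] L} {g₁ : L →ₗ[R] M} (h₁ : IsShortExact f₁ g₁)
    {f₂ : L →ₗ[R] N} {g₂ : N →ₗ[R] P} (h₂ : IsShortExact f₂ g₂) :
    ∃ (i : M →ₗ[R] N ⧸ LinearMap.range (f₂ ∘ₗ f₁)) (p : (N ⧸ LinearMap.range (f₂ ∘ₗ f₁)) →ₗ[R] P),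
      IsShortExact i p := by
  have h₁₂ := isShortExact_mkQ_range (f := f₂ ∘ₗ f₁) (h₂.injective.comp h₁.injective)
  set q := (LinearMap.range (f₂ ∘ₗ f₁)).mkQ
  obtain ⟨i, hi⟩ := h₁.exists_desc (q ∘ₗ f₂) fun x => h₁₂.apply_apply x
  obtain ⟨p, hp⟩ := h₁₂.exists_desc g₂ fun x => h₂.apply_apply (f₁ x)
  replace hi : ∀ x, i (g₁ x) = q (f₂ x) := LinearMap.congr_fun hi
  replace hp : ∀ x, p (q x) = g₂ x := LinearMap.congr_fun hp
  refine ⟨i, p, ⟨?_, ?_, ?_⟩⟩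
  · rw [injective_iff_map_eq_zero]
    intro x hx
    obtain ⟨y, rfl⟩ := h₁.surjective x
    rw [hi] at hx
    obtain ⟨z, hz⟩ := (h₁₂.exact _).1 hx
    rw [← h₂.injective hz, h₁.apply_apply]
  · intro x
    obtain ⟨y, rfl⟩ := h₁₂.surjective x
    rw [hp]
    constructor
    · intro hy
      obtain ⟨z, rfl⟩ := (h₂.exact _).1 hy
      exact ⟨g₁ z, hi z⟩
    · rintro ⟨z, hz⟩
      obtain ⟨w, rfl⟩ := h₁.surjective z
      rw [hi] at hz
      rw [← hp, ← hz, hp, h₂.apply_apply]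
  · intro x
    obtain ⟨y, rfl⟩ := h₂.surjective x
    exact ⟨q y, hp y⟩

/-- Horseshoe lemma: a presentation of the middle term of a short exact sequence. -/
theorem IsShortExact.exists_horseshoe {f : L →ₗ[R] M} {g : M →ₗ[R] N} (h : IsShortExact f g)
    [Module.Projective R Q] {K' : Type*} [AddCommGroup K'] [Module R K']
    {a : K →ₗ[R] P} {b : P →ₗ[R] L} (hL : IsShortExact a b)
    {a' : K' →ₗ[R] Q} {b' : Q →ₗ[R] N} (hN : IsShortExact a' b') :
    ∃ (c : P × Q →ₗ[R] M) (i : K →ₗ[R] LinearMap.ker c) (p : LinearMap.ker c →ₗ[R] K'),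
      Function.Surjective c ∧ IsShortExact i p := by
  obtain ⟨s, hs⟩ := Module.projective_lifting_property g b' h.surjective
  replace hs : ∀ x, g (s x) = b' x := LinearMap.congr_fun hs
  let c : P × Q →ₗ[R] M := (f ∘ₗ b).coprod s
  have hc : ∀ x, c x = f (b x.1) + s x.2 := fun x => rfl
  have hgc : ∀ x, g (c x) = b' x.2 := fun x => by simp [hc, hs, h.apply_apply]
  obtain ⟨p, hp⟩ := hN.exists_lift (LinearMap.snd R P Q ∘ₗ (LinearMap.ker c).subtype)
    fun x => by
      have := hgc x.1
      rw [x.2, map_zero] at this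
      exact this.symm
  replace hp : ∀ x, a' (p x) = x.1.2 := LinearMap.congr_fun hp
  refine ⟨c, (LinearMap.inl R P Q ∘ₗ a).codRestrict _ fun x => ?_, p, ?_, ?_, ?_, ?_⟩
  · simp [hc, hL.apply_apply]
  · intro m
    obtain ⟨q, hq⟩ := hN.surjective (g m)
    obtain ⟨l, hl⟩ := (h.exact (m - s q)).1 (by rw [map_sub, hs, hq, sub_self])
    obtain ⟨x, rfl⟩ := hL.surjective l
    exact ⟨(x, q), by simp [hc, hl]⟩
  · intro x y hxy
    exact hL.injective (congrArg (fun z => z.1.1) hxy)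
  · intro x
    rw [← hN.injective.eq_iff, hp, map_zero]
    constructor
    · intro hx
      have h0 : f (b x.1.1) = 0 := by
        have := x.2
        rwa [LinearMap.mem_ker, hc, hx, map_zero, add_zero] at this
      rw [map_eq_zero_iff f h.injective] at h0
      obtain ⟨y, hy⟩ := (hL.exact _).1 h0
      exact ⟨y, Subtype.ext (Prod.ext hy hx.symm)⟩
    · rintro ⟨y, rfl⟩
      rfl
  · intro y
    have h0 : g (s (a' y)) = 0 := by rw [hs, hN.apply_apply]
    obtain ⟨l, hl⟩ := (h.exact _).1 h0
    obtain ⟨x, rfl⟩ := hL.surjective l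
    exact ⟨⟨(-x, a' y), by simp [hc, hl]⟩, hN.injective (hp _)⟩

/-- Dual horseshoe: a copresentation of the middle term of a short exact sequence, given an
extension of the copresentation of the left term. -/
theorem IsShortExact.exists_dual_horseshoe {f : L →ₗ[R] M} {g : M →ₗ[R] N} (h : IsShortExact f g)
    {K' : Type*} [AddCommGroup K'] [Module R K']
    {a : L →ₗ[R] P} {b : P →ₗ[R] K} (hL : IsShortExact a b)
    {a' : N →ₗ[R] Q} {b' : Q →ₗ[R] K'} (hN : IsShortExact a' b')
    (t : M →ₗ[R] P) (ht : t ∘ₗ f = a) :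
    Function.Injective (t.prod (a' ∘ₗ g)) ∧
    ∃ (i : K →ₗ[R] (P × Q) ⧸ LinearMap.range (t.prod (a' ∘ₗ g)))
      (p : ((P × Q) ⧸ LinearMap.range (t.prod (a' ∘ₗ g))) →ₗ[R] K'), IsShortExact i p := by
  replace ht : ∀ x, t (f x) = a x := LinearMap.congr_fun ht
  set c := t.prod (a' ∘ₗ g)
  have hc : ∀ x, c x = (t x, a' (g x)) := fun x => rfl
  have hci : Function.Injective c := by
    rw [injective_iff_map_eq_zero]
    intro x hx
    rw [hc, Prod.mk_eq_zero, map_eq_zero_iff a' hN.injective] at hx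
    obtain ⟨y, rfl⟩ := (h.exact _).1 hx.2
    rw [ht, map_eq_zero_iff a hL.injective] at hx
    rw [hx.1, map_zero]
  have hq := isShortExact_mkQ_range hci
  set q := (LinearMap.range c).mkQ
  obtain ⟨i, hi⟩ := hL.exists_desc (q ∘ₗ LinearMap.inl R P Q) fun x => by
    rw [← hq.apply_apply (f x), hc, h.apply_apply, ht, map_zero]
    rfl
  obtain ⟨p, hp⟩ := hq.exists_desc (b' ∘ₗ LinearMap.snd R P Q) fun x => hN.apply_apply (g x)
  replace hi : ∀ x, i (b x) = q (x, 0) := LinearMap.congr_fun hi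
  replace hp : ∀ x, p (q x) = b' x.2 := LinearMap.congr_fun hp
  refine ⟨hci, i, p, ?_, ?_, ?_⟩
  · rw [injective_iff_map_eq_zero]
    intro x hx
    obtain ⟨y, rfl⟩ := hL.surjective x
    rw [hi] at hx
    obtain ⟨m, hm⟩ := (hq.exact _).1 hx
    rw [hc, Prod.mk.injEq, map_eq_zero_iff a' hN.injective] at hm
    obtain ⟨l, rfl⟩ := (h.exact _).1 hm.2
    rw [← hm.1, ht, hL.apply_apply]
  · intro x
    obtain ⟨⟨x, y⟩, rfl⟩ := hq.surjective x
    rw [hp]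
    constructor
    · intro hy
      obtain ⟨n, hn⟩ := (hN.exact _).1 hy
      obtain ⟨m, rfl⟩ := h.surjective n
      refine ⟨b (x - t m), ?_⟩
      rw [hi, ← sub_eq_zero, ← map_sub, ← neg_eq_zero, ← map_neg]
      refine (hq.exact _).2 ⟨m, ?_⟩
      simpa [hc] using hn
    · rintro ⟨z, hz⟩
      obtain ⟨w, rfl⟩ := hL.surjective z
      rw [hi] at hz
      have := congrArg p hz
      rw [hp, hp, map_zero] at this
      exact this.symm
  · intro x
    obtain ⟨y, rfl⟩ := hN.surjective x
    exact ⟨q (0, y), hp _⟩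

/-- Schanuel's lemma. -/
theorem IsShortExact.nonempty_schanuel {f : K →ₗ[R] P} {g : P →ₗ[R] M} (h : IsShortExact f g)
    {f' : L →ₗ[R] Q} {g' : Q →ₗ[R] M} (h' : IsShortExact f' g')
    [Module.Projective R P] [Module.Projective R Q] : Nonempty ((K × Q) ≃ₗ[R] (L × P)) := by
  obtain ⟨s, hs⟩ := Module.projective_lifting_property g' g h'.surjective
  obtain ⟨t, ht⟩ := Module.projective_lifting_property g g' h.surjective
  replace hs : ∀ x, g' (s x) = g x := LinearMap.congr_fun hs
  replace ht : ∀ x, g (t x) = g' x := LinearMap.congr_fun ht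
  -- The isomorphism sends (x, y) to (a, f x + t y), where a ∈ L corrects the error y - s (f x + t
  -- y). The inverse is given by the same formula with the two presentations exchanged.
  obtain ⟨a, ha⟩ := h'.exists_lift (LinearMap.snd R K Q - s ∘ₗ (f.coprod t)) fun x => by
    simp [hs, ht, h.apply_apply]
  obtain ⟨b, hb⟩ := h.exists_lift (LinearMap.snd R L P - t ∘ₗ (f'.coprod s)) fun x => by
    simp [hs, ht, h'.apply_apply]
  replace ha : ∀ x, f' (a x) = x.2 - s (f x.1 + t x.2) := LinearMap.congr_fun ha
  replace hb : ∀ x, f (b x) = x.2 - t (f' x.1 + s x.2) := LinearMap.congr_fun hb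
  refine ⟨LinearEquiv.ofLinearMap (a.prod (f.coprod t)) (b.prod (f'.coprod s)) ?_ ?_⟩
  · refine LinearMap.ext fun x => Prod.ext (h'.injective ?_) ?_
    · simp [ha, hb]
    · simp [hb]
  · refine LinearMap.ext fun x => Prod.ext (h.injective ?_) ?_
    · simp [ha, hb]
    · simp [ha]

end Lifting

/-! ### Vanishing of Ext¹ into the ring. -/

section ExtOne

variable {R : Type v} [Ring R]

/-- `Ext¹_R(N, R) = 0`, in terms of extensions: in every short exact sequence `0 → L → M → N → 0`
linear maps `L → R` extend to `M`. -/
def ExtOneVanishes (N : ModuleCat.{w} R) : Prop :=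
  ∀ ⦃L M : ModuleCat.{w} R⦄ (f : L →ₗ[R] M) (g : M →ₗ[R] N), IsShortExact f g →
    ∀ φ : L →ₗ[R] R, ∃ ψ : M →ₗ[R] R, ψ ∘ₗ f = φ

/-- One projective presentation decides about all extensions: lifting P → N to M induces a map K →
L, and M is the pushout of L and P along K, so forms on L and P that agree on K glue to a form on M.
-/
theorem ExtOneVanishes.of_presentation {K P : Type*} [AddCommGroup K] [Module R K]
    [AddCommGroup P] [Module R P] [Module.Projective R P] {N : ModuleCat.{w} R}
    {a : K →ₗ[R] P} {b : P →ₗ[R] N} (h : IsShortExact a b)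
    (hext : ∀ φ : K →ₗ[R] R, ∃ ψ : P →ₗ[R] R, ψ ∘ₗ a = φ) : ExtOneVanishes N := by
  intro L M f g hfg φ
  obtain ⟨s, hs⟩ := Module.projective_lifting_property g b hfg.surjective
  replace hs : ∀ x, g (s x) = b x := LinearMap.congr_fun hs
  obtain ⟨t, ht⟩ := hfg.exists_lift (s ∘ₗ a) fun x => by simp [hs, h.apply_apply]
  replace ht : ∀ x, f (t x) = s (a x) := LinearMap.congr_fun ht
  obtain ⟨ψ, hψ⟩ := hext (φ ∘ₗ t)
  replace hψ : ∀ x, ψ (a x) = φ (t x) := LinearMap.congr_fun hψ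
  have hsurj : Function.Surjective (f.coprod s) := fun m => by
    obtain ⟨p, hp⟩ := h.surjective (g m)
    obtain ⟨l, hl⟩ := (hfg.exact (m - s p)).1 (by rw [map_sub, hs, hp, sub_self])
    exact ⟨(l, p), by simp [hl]⟩
  obtain ⟨χ, hχ⟩ := LinearMap.exists_comp_eq_of_surjective hsurj (φ.coprod ψ) fun x hx => by
    rw [LinearMap.coprod_apply] at hx ⊢
    have h0 : b x.2 = 0 := by
      have := congrArg g hx
      rwa [map_add, hfg.apply_apply, hs, zero_add, map_zero] at this
    obtain ⟨k, hk⟩ := (h.exact _).1 h0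
    rw [← hk, ← ht, ← map_add, map_eq_zero_iff f hfg.injective] at hx
    rw [← hk, hψ, ← map_add, hx, map_zero]
  refine ⟨χ, LinearMap.ext fun l => ?_⟩
  have := LinearMap.congr_fun hχ (l, 0)
  simpa using this

theorem ExtOneVanishes.of_projective (N : ModuleCat.{w} R) [Module.Projective R N] :
    ExtOneVanishes N :=
  .of_presentation (isShortExact_equiv_right (L := PUnit.{1}) (LinearEquiv.refl R N))
    fun φ => ⟨0, LinearMap.ext fun x => by
      rw [Subsingleton.elim x 0, map_zero, map_zero]⟩

theorem ExtOneVanishes.exists_extend {L M N : Type w} [AddCommGroup L] [Module R L]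
    [AddCommGroup M] [Module R M] [AddCommGroup N] [Module R N]
    (hN : ExtOneVanishes (ModuleCat.of R N)) {f : L →ₗ[R] M} {g : M →ₗ[R] N}
    (h : IsShortExact f g) (φ : L →ₗ[R] R) : ∃ ψ : M →ₗ[R] R, ψ ∘ₗ f = φ :=
  hN (L := ModuleCat.of R L) (M := ModuleCat.of R M) f g h φ

theorem ExtOneVanishes.exists_extend_of_projective {L M N : Type w} [AddCommGroup L] [Module R L]
    [AddCommGroup M] [Module R M] [AddCommGroup N] [Module R N] {P : Type*} [AddCommGroup P]
    [Module R P] [Module.Finite R P] [Module.Projective R P]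
    (hN : ExtOneVanishes (ModuleCat.of R N)) {f : L →ₗ[R] M} {g : M →ₗ[R] N}
    (h : IsShortExact f g) (φ : L →ₗ[R] P) : ∃ ψ : M →ₗ[R] P, ψ ∘ₗ f = φ := by
  obtain ⟨n, p, hp⟩ := Module.Finite.exists_fin' R P
  obtain ⟨s, hs⟩ := Module.projective_lifting_property p LinearMap.id hp
  choose ψ hψ using fun j => hN.exists_extend h (LinearMap.proj j ∘ₗ s ∘ₗ φ)
  refine ⟨p ∘ₗ LinearMap.pi ψ, LinearMap.ext fun x => ?_⟩
  have h1 : LinearMap.pi ψ (f x) = s (φ x) := funext fun j => LinearMap.congr_fun (hψ j) x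
  rw [LinearMap.comp_apply, LinearMap.comp_apply, h1]
  exact LinearMap.congr_fun hs _

theorem ExtOneVanishes.of_isShortExact {L M N : ModuleCat.{w} R} (hL : ExtOneVanishes L)
    (hN : ExtOneVanishes N) {f : L →ₗ[R] M} {g : M →ₗ[R] N} (h : IsShortExact f g) :
    ExtOneVanishes M := by
  intro K E a b hab φ
  obtain ⟨i, p, hip, hi, hp⟩ := hab.exists_ker_comp h
  obtain ⟨ψ, hψ⟩ := hL.exists_extend hip φ
  obtain ⟨χ, hχ⟩ := hN.exists_extend (isShortExact_ker (g := g ∘ₗ b)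
    (h.surjective.comp hab.surjective)) ψ
  exact ⟨χ, by rw [← hψ, ← hχ, ← hi]; rfl⟩

theorem ExtOneVanishes.of_prod {M : ModuleCat.{w} R} {M' : Type w} [AddCommGroup M']
    [Module R M'] (h : ExtOneVanishes (ModuleCat.of R (M × M'))) : ExtOneVanishes M := by
  intro K E a b hab φ
  have hid : IsShortExact (0 : PUnit.{w+1} →ₗ[R] M') (LinearMap.id : M' →ₗ[R] M') :=
    isShortExact_equiv_right (LinearEquiv.refl R M')
  obtain ⟨ψ, hψ⟩ := h.exists_extend (hab.prodMap hid) (φ ∘ₗ LinearMap.fst R _ _)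
  refine ⟨ψ ∘ₗ LinearMap.inl R _ _, LinearMap.ext fun x => ?_⟩
  simpa using LinearMap.congr_fun hψ (x, 0)

theorem ExtOneVanishes.of_equiv {M N : ModuleCat.{w} R} (h : ExtOneVanishes M)
    (e : M ≃ₗ[R] N) : ExtOneVanishes N := fun _ _ f g hfg φ =>
  h f (e.symm.toLinearMap ∘ₗ g) ⟨hfg.injective, fun x => by simp [← hfg.exact x],
    e.symm.surjective.comp hfg.surjective⟩ φ

/-- If maps to `R` extend along the kernels of two surjections, they extend along the kernel of the
composite. -/
theorem IsShortExact.exists_extend_ker_comp {K L M N P : Type*} [AddCommGroup K] [Module R K]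
    [AddCommGroup L] [Module R L] [AddCommGroup M] [Module R M] [AddCommGroup N] [Module R N]
    [AddCommGroup P] [Module R P]
    {f₁ : K →ₗ[R] M} {g₁ : M →ₗ[R] N} (h₁ : IsShortExact f₁ g₁)
    {f₂ : L →ₗ[R] N} {g₂ : N →ₗ[R] P} (h₂ : IsShortExact f₂ g₂)
    (hext₁ : ∀ φ : K →ₗ[R] R, ∃ ψ : M →ₗ[R] R, ψ ∘ₗ f₁ = φ)
    (hext₂ : ∀ φ : L →ₗ[R] R, ∃ ψ : N →ₗ[R] R, ψ ∘ₗ f₂ = φ)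
    (φ : LinearMap.ker (g₂ ∘ₗ g₁) →ₗ[R] R) :
    ∃ ψ : M →ₗ[R] R, ψ ∘ₗ (LinearMap.ker (g₂ ∘ₗ g₁)).subtype = φ := by
  obtain ⟨i, p, hip, hi, hp⟩ := h₁.exists_ker_comp h₂
  obtain ⟨ψ, hψ⟩ := hext₁ (φ ∘ₗ i)
  obtain ⟨χ, hχ⟩ := hip.exists_desc (φ - ψ ∘ₗ (LinearMap.ker (g₂ ∘ₗ g₁)).subtype) fun x => by
    have h1 := LinearMap.congr_fun hi x
    have h2 := LinearMap.congr_fun hψ x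
    simp only [LinearMap.comp_apply] at h1 h2
    rw [LinearMap.sub_apply, LinearMap.comp_apply, h1, h2, sub_self]
  obtain ⟨ω, hω⟩ := hext₂ χ
  refine ⟨ψ + ω ∘ₗ g₁, ?_⟩
  rw [LinearMap.add_comp, LinearMap.comp_assoc, ← hp, ← LinearMap.comp_assoc, hω, hχ]
  abel

end ExtOne

/-! ### Extension closure and filtrations. -/

section Closure

variable {R : Type v} [Ring R]

/-- The modules built from `0` by finitely many extensions by modules in `𝒳`. -/
inductive ExtClosure (𝒳 : ObjectProperty (ModuleCat.{w} R)) : ModuleCat.{w} R → Prop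
  | zero (M : ModuleCat.{w} R) [Subsingleton M] : ExtClosure 𝒳 M
  | step {L M N : ModuleCat.{w} R} (f : L →ₗ[R] M) (g : M →ₗ[R] N) (h : IsShortExact f g)
      (hL : ExtClosure 𝒳 L) (hN : 𝒳 N) : ExtClosure 𝒳 M

/-- The class `𝒲` contains the middle term of every short exact sequence whose outer terms are
in `𝒲`. -/
def IsExtClosed (𝒲 : ObjectProperty (ModuleCat.{w} R)) : Prop :=
  ∀ ⦃L M N : ModuleCat.{w} R⦄ (f : L →ₗ[R] M) (g : M →ₗ[R] N), IsShortExact f g →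
    𝒲 L → 𝒲 N → 𝒲 M

theorem IsExtClosed.of_equiv {𝒲 : ObjectProperty (ModuleCat.{w} R)} (h : IsExtClosed 𝒲)
    (h0 : ∀ M : ModuleCat.{w} R, Subsingleton M → 𝒲 M) {M N : ModuleCat.{w} R} (hM : 𝒲 M)
    (e : M ≃ₗ[R] N) : 𝒲 N :=
  h _ _ (isShortExact_equiv_left (N := ModuleCat.of R PUnit.{w+1}) e) hM
    (h0 (ModuleCat.of R PUnit.{w+1}) (inferInstanceAs (Subsingleton PUnit)))

theorem ExtClosure.of {𝒳 : ObjectProperty (ModuleCat.{w} R)} {M : ModuleCat.{w} R} (h : 𝒳 M) :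
    ExtClosure 𝒳 M :=
  have : Subsingleton (ModuleCat.of R PUnit.{w+1}) := inferInstanceAs (Subsingleton PUnit)
  .step _ _ (isShortExact_equiv_right (LinearEquiv.refl R M))
    (.zero (ModuleCat.of R PUnit.{w+1})) h

theorem isExtClosed_extClosure (𝒳 : ObjectProperty (ModuleCat.{w} R)) :
    IsExtClosed (ExtClosure 𝒳) := by
  intro L M N f g h hL hN
  induction hN generalizing M with
  | zero N =>
    -- Here f is an isomorphism. Invariance of `ExtClosure` under isomorphism is deduced from this
    -- very theorem, so the last extension step of L is transported to M by hand.
    cases hL with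
    | zero =>
      have : Subsingleton M := ⟨fun x y => by
        obtain ⟨a, rfl⟩ := (h.exact x).1 (Subsingleton.elim _ _)
        obtain ⟨b, rfl⟩ := (h.exact y).1 (Subsingleton.elim _ _)
        rw [Subsingleton.elim a b]⟩
      exact .zero M
    | step f' g' h' hL' hN' =>
      have hf : Function.Bijective f :=
        ⟨h.injective, fun x => (h.exact x).1 (Subsingleton.elim _ _)⟩
      let e := LinearEquiv.ofBijective f hf
      refine .step (f ∘ₗ f') (g' ∘ₗ e.symm.toLinearMap)
        ⟨h.injective.comp h'.injective, fun x => ?_, h'.surjective.comp e.symm.surjective⟩ hL' hN'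
      obtain ⟨y, rfl⟩ := e.surjective x
      rw [LinearMap.comp_apply, LinearEquiv.coe_coe, e.symm_apply_apply, h'.exact]
      exact ⟨fun ⟨z, hz⟩ => ⟨z, congrArg f hz⟩, fun ⟨z, hz⟩ => ⟨z, h.injective hz⟩⟩
  | step f' g' h' hL' hN' ih =>
    obtain ⟨i, p, hip, -, -⟩ := h.exists_ker_comp h'
    exact .step (L := ModuleCat.of R (LinearMap.ker (g' ∘ₗ g)))
      (LinearMap.ker (g' ∘ₗ g)).subtype (g' ∘ₗ g)
      (isShortExact_ker (g := g' ∘ₗ g) (h'.surjective.comp h.surjective)) (ih i p hip) hN'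

theorem ExtClosure.of_equiv {𝒳 : ObjectProperty (ModuleCat.{w} R)} {M N : ModuleCat.{w} R}
    (h : ExtClosure 𝒳 M) (e : M ≃ₗ[R] N) : ExtClosure 𝒳 N :=
  (isExtClosed_extClosure 𝒳).of_equiv (fun M _ => .zero M) h e

theorem filt.of_extClosure {𝒳 : ObjectProperty (ModuleCat.{w} R)}
    (hiso : ∀ ⦃M N : ModuleCat.{w} R⦄, (M ≃ₗ[R] N) → 𝒳 M → 𝒳 N) {M : ModuleCat.{w} R}
    (h : ExtClosure 𝒳 M) : filt 𝒳 M := by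
  induction h with
  | zero M => exact ⟨0, fun _ => ⊥, rfl, Subsingleton.elim _ _, fun i => i.elim0⟩
  | @step L M N f g h hL hN ih =>
    obtain ⟨m, F, h0, hm, hF⟩ := ih
    -- The images of the filtration of L, followed by M itself as the last term; the new factor is M
    -- / f(L) ≅ N.
    refine ⟨m + 1, Fin.snoc (α := fun _ => Submodule R M) (fun i => (F i).map f) ⊤, ?_, ?_, ?_⟩
    · rw [← Fin.castSucc_zero, Fin.snoc_castSucc, h0, Submodule.map_bot]
    · rw [Fin.snoc_last]
    · intro i
      induction i using Fin.lastCases with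
      | last =>
        rw [Fin.snoc_castSucc, Fin.succ_last, Fin.snoc_last, hm, Submodule.map_top]
        refine ⟨le_top, hiso (LinearEquiv.symm ?_) hN⟩
        let g' : (⊤ : Submodule R M) →ₗ[R] N := g ∘ₗ Submodule.subtype ⊤
        refine LinearEquiv.trans (Submodule.quotEquivOfEq _ (LinearMap.ker g') ?_)
          (g'.quotKerEquivOfSurjective (h.surjective.comp Submodule.topEquiv.surjective))
        ext x
        rw [Submodule.submoduleOf, Submodule.mem_comap, LinearMap.mem_ker, LinearMap.comp_apply]
        exact (h.exact _).symm
      | cast i =>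
        rw [Fin.snoc_castSucc, Fin.succ_castSucc, Fin.snoc_castSucc]
        refine ⟨Submodule.map_mono (hF i).1, hiso ?_ (hF i).2⟩
        refine Submodule.Quotient.equiv _ _ (Submodule.equivMapOfInjective f h.injective _) ?_
        ext ⟨x, hx⟩
        simp only [Submodule.mem_map, Submodule.submoduleOf, Submodule.mem_comap]
        constructor
        · rintro ⟨y, hy, hyx⟩
          exact ⟨y, hy, congrArg Subtype.val hyx⟩
        · rintro ⟨y, hy, hyx⟩
          exact ⟨⟨y, (hF i).1 hy⟩, hy, Subtype.ext hyx⟩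

theorem filt.extClosure {𝒳 : ObjectProperty (ModuleCat.{w} R)} {M : ModuleCat.{w} R}
    (h : filt 𝒳 M) : ExtClosure 𝒳 M := by
  obtain ⟨m, F, h0, hm, hF⟩ := h
  have key : ∀ i, ExtClosure 𝒳 (ModuleCat.of R (F i)) := by
    intro i
    induction i using Fin.induction with
    | zero =>
      have : Subsingleton (ModuleCat.of R (F 0)) := by
        rw [h0]
        exact inferInstanceAs (Subsingleton (⊥ : Submodule R M))
      exact .zero _
    | succ i ih =>
      refine .step (L := ModuleCat.of R (F i.castSucc))
        (M := ModuleCat.of R (F i.succ)) (Submodule.inclusion (hF i).1)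
        ((F i.castSucc).submoduleOf (F i.succ)).mkQ
        ⟨Submodule.inclusion_injective _, fun x => ?_, Submodule.mkQ_surjective _⟩ ih (hF i).2
      rw [Submodule.mkQ_apply, Submodule.Quotient.mk_eq_zero]
      exact ⟨fun hx => ⟨⟨x, hx⟩, rfl⟩, fun ⟨y, hy⟩ => hy ▸ y.2⟩
  have h := key (Fin.last m)
  rw [hm] at h
  exact h.of_equiv Submodule.topEquiv

end Closure

/-! ### Gorenstein projective modules: coinduction, extensions and summands. -/

section GorensteinProjective

variable {R : Type v} [Ring R]

/-- `M` is a quotient of a finitely generated projective module with kernel in `𝒲`. -/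
def HasPresentation (𝒲 : ObjectProperty (ModuleCat.{w} R)) : ObjectProperty (ModuleCat.{w} R) :=
  fun M => ∃ (K P : ModuleCat.{w} R) (a : K →ₗ[R] P) (b : P →ₗ[R] M),
    Module.Finite R P ∧ Module.Projective R P ∧ IsShortExact a b ∧ 𝒲 K

/-- `M` is a submodule of a finitely generated projective module with cokernel in `𝒲`. -/
def HasCopresentation (𝒲 : ObjectProperty (ModuleCat.{w} R)) : ObjectProperty (ModuleCat.{w} R) :=
  fun M => ∃ (P C : ModuleCat.{w} R) (a : M →ₗ[R] P) (b : P →ₗ[R] C),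
    Module.Finite R P ∧ Module.Projective R P ∧ IsShortExact a b ∧ 𝒲 C

theorem HasPresentation.mono {𝒲 𝒲' : ObjectProperty (ModuleCat.{w} R)} (h : 𝒲 ≤ 𝒲') :
    HasPresentation 𝒲 ≤ HasPresentation 𝒲' :=
  fun _ ⟨K, P, a, b, h1, h2, h3, h4⟩ => ⟨K, P, a, b, h1, h2, h3, h _ h4⟩

theorem HasCopresentation.mono {𝒲 𝒲' : ObjectProperty (ModuleCat.{w} R)} (h : 𝒲 ≤ 𝒲') :
    HasCopresentation 𝒲 ≤ HasCopresentation 𝒲' :=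
  fun _ ⟨K, P, a, b, h1, h2, h3, h4⟩ => ⟨K, P, a, b, h1, h2, h3, h _ h4⟩

theorem IsExtClosed.hasPresentation {𝒲 : ObjectProperty (ModuleCat.{w} R)} (h𝒲 : IsExtClosed 𝒲) :
    IsExtClosed (HasPresentation 𝒲) := by
  rintro L M N f g h ⟨K, P, a, b, hP, hP', hab, hK⟩ ⟨K', Q, a', b', hQ, hQ', hab', hK'⟩
  obtain ⟨c, i, p, hc, hip⟩ := h.exists_horseshoe hab hab'
  exact ⟨ModuleCat.of R (LinearMap.ker c), ModuleCat.of R (P × Q), (LinearMap.ker c).subtype, c,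
    inferInstanceAs (Module.Finite R (P × Q)), inferInstanceAs (Module.Projective R (P × Q)),
    isShortExact_ker hc, h𝒲 (M := ModuleCat.of R (LinearMap.ker c)) i p hip hK hK'⟩

/-- Unlike for presentations, Ext¹ enters: the embedding of L into P has to be extended to M before
the dual horseshoe applies, and the obstruction lies in Ext¹(N, P). -/
theorem IsExtClosed.hasCopresentation {𝒲 : ObjectProperty (ModuleCat.{w} R)}
    (h𝒲 : IsExtClosed 𝒲) {L M N : ModuleCat.{w} R} {f : L →ₗ[R] M} {g : M →ₗ[R] N}
    (h : IsShortExact f g) (hN : ExtOneVanishes N) :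
    HasCopresentation 𝒲 L → HasCopresentation 𝒲 N → HasCopresentation 𝒲 M := by
  rintro ⟨P, K, a, b, hP, hP', hab, hK⟩ ⟨Q, K', a', b', hQ, hQ', hab', hK'⟩
  obtain ⟨t, ht⟩ := hN.exists_extend_of_projective h a
  obtain ⟨hc, i, p, hip⟩ := h.exists_dual_horseshoe hab hab' t ht
  let c : M →ₗ[R] P × Q := t.prod (a' ∘ₗ g)
  exact ⟨ModuleCat.of R (P × Q), ModuleCat.of R ((P × Q) ⧸ LinearMap.range c), c,
    (LinearMap.range c).mkQ,
    inferInstanceAs (Module.Finite R (P × Q)), inferInstanceAs (Module.Projective R (P × Q)),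
    isShortExact_mkQ_range hc,
    h𝒲 (M := ModuleCat.of R ((P × Q) ⧸ LinearMap.range c)) i p hip hK hK'⟩

/-- Iterated choices of successors and predecessors. The base point sits at 1 because a complete
resolution presents its module as the kernel of d¹. -/
theorem exists_int_chain {α : Type*} (r : α → α → Prop) (hl : ∀ x, ∃ y, r y x)
    (hr : ∀ x, ∃ y, r x y) (x : α) : ∃ s : ℤ → α, s 1 = x ∧ ∀ i, r (s i) (s (i + 1)) := by
  choose p hp using hl
  choose n hn using hr
  suffices h : ∃ s : ℤ → α, s 0 = x ∧ ∀ i, r (s i) (s (i + 1)) by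
    obtain ⟨s, h0, hs⟩ := h
    refine ⟨fun i => s (i - 1), by simpa using h0, fun i => ?_⟩
    have := hs (i - 1)
    rwa [show i - 1 + 1 = i + 1 - 1 by ring] at this
  refine ⟨fun i => Int.rec (fun j => n^[j] x) (fun j => p^[j + 1] x) i, rfl, fun i => ?_⟩
  match i with
  | .ofNat j =>
    change r (n^[j] x) (n^[j + 1] x)
    rw [Function.iterate_succ_apply']
    exact hn _
  | .negSucc 0 => exact hp x
  | .negSucc (j + 1) =>
    change r (p^[j + 1 + 1] x) (p^[j + 1] x)
    rw [Function.iterate_succ_apply']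
    exact hp _

/-- Coinduction principle for Gorenstein projective modules. -/
theorem le_gorensteinProjective {𝒲 : ObjectProperty (ModuleCat.{w} R)}
    (hext : 𝒲 ≤ ExtOneVanishes) (hpres : 𝒲 ≤ HasPresentation 𝒲)
    (hcopres : 𝒲 ≤ HasCopresentation 𝒲) : 𝒲 ≤ gorensteinProjective R := by
  intro G hG
  let r : {M // 𝒲 M} → {M // 𝒲 M} → Prop := fun M N =>
    ∃ (P : ModuleCat.{w} R) (a : M.1 →ₗ[R] P) (b : P →ₗ[R] N.1),
      Module.Finite R P ∧ Module.Projective R P ∧ IsShortExact a b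
  obtain ⟨s, hs, hr⟩ := exists_int_chain r
    (fun M => by
      obtain ⟨K, P, a, b, h1, h2, h3, h4⟩ := hpres M.1 M.2
      exact ⟨⟨K, h4⟩, P, a, b, h1, h2, h3⟩)
    (fun M => by
      obtain ⟨P, C, a, b, h1, h2, h3, h4⟩ := hcopres M.1 M.2
      exact ⟨⟨C, h4⟩, P, a, b, h1, h2, h3⟩) ⟨G, hG⟩
  choose P a b hfin hproj hab using hr
  have hker : ∀ i, Function.Exact (a (i + 1) ∘ₗ b i) (a (i + 1 + 1) ∘ₗ b (i + 1)) := fun i x => by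
    rw [LinearMap.comp_apply, map_eq_zero_iff _ (hab _).injective, (hab _).exact]
    constructor
    · rintro ⟨y, rfl⟩
      obtain ⟨z, rfl⟩ := (hab i).surjective y
      exact ⟨z, rfl⟩
    · rintro ⟨y, rfl⟩
      exact ⟨_, rfl⟩
  have hG' : LinearMap.range (a 1) = LinearMap.ker (a (1 + 1) ∘ₗ b 1) := by
    ext x
    rw [LinearMap.mem_ker, LinearMap.comp_apply, map_eq_zero_iff _ (hab _).injective,
      (hab _).exact]
    rfl
  have hs1 : (s 1).1 = G := congrArg Subtype.val hs
  refine ⟨⟨P, fun i => a (i + 1) ∘ₗ b i, hfin, hproj, hker, fun i ψ => ⟨fun h => ?_, ?_⟩, ?_⟩⟩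
  · have h' : ∀ x, ψ (a (i + 1) x) = 0 := fun x => by
      obtain ⟨y, rfl⟩ := (hab i).surjective x
      exact LinearMap.congr_fun h y
    -- A form that vanishes on the image of the previous differential descends to the next syzygy,
    -- and from there extends to the next projective because Ext¹ of the syzygy after that vanishes.
    obtain ⟨χ, hχ⟩ := (hab (i + 1)).exists_desc ψ h'
    obtain ⟨ω, hω⟩ := (hext _ (s (i + 1 + 1 + 1)).2).exists_extend (hab (i + 1 + 1)) χ
    refine ⟨ω, ?_⟩
    change ω ∘ₗ (a (i + 1 + 1) ∘ₗ b (i + 1)) = ψ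
    rw [← LinearMap.comp_assoc, hω, hχ]
  · rintro ⟨ω, rfl⟩
    refine LinearMap.ext fun x => ?_
    change ω (a (i + 1 + 1) (b (i + 1) (a (i + 1) (b i x)))) = 0
    rw [(hab _).apply_apply, map_zero, map_zero]
  · exact (eqToIso hs1.symm).toLinearEquiv.trans ((LinearEquiv.ofInjective (a 1)
      (hab 1).injective).trans (LinearEquiv.ofEq _ _ hG'))

theorem CompleteProjectiveResolution.isShortExact {G : ModuleCat.{w} R}
    (C : CompleteProjectiveResolution R G) (i : ℤ) :
    IsShortExact (LinearMap.ker (C.d i)).subtype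
      ((C.d i).codRestrict (LinearMap.ker (C.d (i + 1))) fun x =>
        (C.exact i).apply_apply_eq_zero x) := by
  refine ⟨Subtype.val_injective, fun x => ?_, fun x => ?_⟩
  · rw [Subtype.ext_iff]
    exact ⟨fun h => ⟨⟨x, h⟩, rfl⟩, fun ⟨y, hy⟩ => hy ▸ y.2⟩
  · obtain ⟨y, hy⟩ := (C.exact i _).1 x.2
    exact ⟨y, Subtype.ext hy⟩

theorem CompleteProjectiveResolution.extOneVanishes {G : ModuleCat.{w} R}
    (C : CompleteProjectiveResolution R G) (i : ℤ) :
    ExtOneVanishes (ModuleCat.of R (LinearMap.ker (C.d i))) := by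
  -- The shift by three makes the indices agree definitionally with those of `hom_exact`, which is
  -- applied to a form on the kernel in degree j + 2, pulled back to P (j + 1).
  obtain ⟨i, rfl⟩ : ∃ j, i = j + 1 + 1 + 1 := ⟨i - 3, by ring⟩
  have := C.projective (i + 1 + 1)
  refine .of_presentation (C.isShortExact (i + 1 + 1)) fun φ => ?_
  obtain ⟨ψ, hψ⟩ := (C.hom_exact i (φ ∘ₗ (C.d (i + 1)).codRestrict
    (LinearMap.ker (C.d (i + 1 + 1))) fun x => (C.exact (i + 1)).apply_apply_eq_zero x)).1 <|
      LinearMap.ext fun x => by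
        have h0 := (C.exact i).apply_apply_eq_zero x
        simp only [LinearMap.comp_apply, LinearMap.zero_apply]
        rw [← map_zero φ]
        congr 1
        exact Subtype.ext h0
  refine ⟨ψ, LinearMap.ext fun x => ?_⟩
  obtain ⟨y, rfl⟩ := (C.isShortExact (i + 1)).surjective x
  exact LinearMap.congr_fun hψ y

/-- The modules isomorphic to a kernel of some differential in a complete projective resolution. -/
def IsResolutionKernel : ObjectProperty (ModuleCat.{w} R) :=
  fun M => ∃ (G : ModuleCat.{w} R) (C : CompleteProjectiveResolution R G) (i : ℤ),
    Nonempty (M ≃ₗ[R] LinearMap.ker (C.d i))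

theorem IsResolutionKernel.extOneVanishes :
    (IsResolutionKernel : ObjectProperty (ModuleCat.{w} R)) ≤ ExtOneVanishes := by
  rintro M ⟨G, C, i, ⟨e⟩⟩
  exact (C.extOneVanishes i).of_equiv e.symm

theorem IsResolutionKernel.hasPresentation :
    (IsResolutionKernel : ObjectProperty (ModuleCat.{w} R)) ≤
      HasPresentation IsResolutionKernel := by
  rintro M ⟨G, C, i, ⟨e⟩⟩
  obtain ⟨i, rfl⟩ : ∃ j, i = j + 1 := ⟨i - 1, by ring⟩
  have h := C.isShortExact i
  exact ⟨ModuleCat.of R (LinearMap.ker (C.d i)), C.P i, _, e.symm.toLinearMap ∘ₗ _, C.finite i,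
    C.projective i, ⟨h.injective, fun x => by simpa using h.exact x,
      e.symm.surjective.comp h.surjective⟩, G, C, i, ⟨LinearEquiv.refl _ _⟩⟩

theorem IsResolutionKernel.hasCopresentation :
    (IsResolutionKernel : ObjectProperty (ModuleCat.{w} R)) ≤
      HasCopresentation IsResolutionKernel := by
  rintro M ⟨G, C, i, ⟨e⟩⟩
  have h := C.isShortExact i
  refine ⟨C.P i, ModuleCat.of R (LinearMap.ker (C.d (i + 1))), (LinearMap.ker (C.d i)).subtype ∘ₗ
    e.toLinearMap, _, C.finite i,
    C.projective i, ⟨h.injective.comp e.injective, fun x => ?_,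
      h.surjective⟩, G, C, i + 1, ⟨LinearEquiv.refl _ _⟩⟩
  rw [h.exact]
  exact (e.surjective.range_comp _).symm ▸ Iff.rfl

/-- For a kernel in degree other than 1 the coinduction principle builds a fresh resolution, so the
given complex never has to be reindexed. -/
theorem gorensteinProjective_eq_isResolutionKernel :
    (gorensteinProjective R : ObjectProperty (ModuleCat.{w} R)) = IsResolutionKernel :=
  le_antisymm (fun G ⟨C⟩ => ⟨G, C, 1, ⟨C.iso⟩⟩)
    (le_gorensteinProjective IsResolutionKernel.extOneVanishes IsResolutionKernel.hasPresentation
      IsResolutionKernel.hasCopresentation)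

theorem gorensteinProjective_extOneVanishes :
    (gorensteinProjective R : ObjectProperty (ModuleCat.{w} R)) ≤ ExtOneVanishes := by
  rw [gorensteinProjective_eq_isResolutionKernel]
  exact IsResolutionKernel.extOneVanishes

theorem gorensteinProjective_hasPresentation :
    (gorensteinProjective R : ObjectProperty (ModuleCat.{w} R)) ≤
      HasPresentation (gorensteinProjective R) := by
  rw [gorensteinProjective_eq_isResolutionKernel]
  exact IsResolutionKernel.hasPresentation

theorem gorensteinProjective_hasCopresentation :
    (gorensteinProjective R : ObjectProperty (ModuleCat.{w} R)) ≤
      HasCopresentation (gorensteinProjective R) := by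
  rw [gorensteinProjective_eq_isResolutionKernel]
  exact IsResolutionKernel.hasCopresentation

theorem gorensteinProjective_finite {M : ModuleCat.{w} R} (h : gorensteinProjective R M) :
    Module.Finite R M := by
  obtain ⟨K, P, a, b, h1, -, h3, -⟩ := gorensteinProjective_hasPresentation M h
  exact Module.Finite.of_surjective b h3.surjective

theorem gorensteinProjective_of_projective (M : ModuleCat.{w} R) [Module.Finite R M]
    [Module.Projective R M] : gorensteinProjective R M := by
  have : Subsingleton (ModuleCat.of R PUnit.{w+1}) := inferInstanceAs (Subsingleton PUnit)
  have hz : Module.Finite R (ModuleCat.of R PUnit.{w+1}) ∧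
      Module.Projective R (ModuleCat.of R PUnit.{w+1}) :=
    ⟨inferInstanceAs (Module.Finite R PUnit.{w+1}),
      inferInstanceAs (Module.Projective R PUnit.{w+1})⟩
  refine le_gorensteinProjective
    (𝒲 := fun M => Module.Finite R M ∧ Module.Projective R M) ?_ ?_ ?_ M ⟨‹_›, ‹_›⟩
  · rintro M ⟨_, _⟩
    exact .of_projective M
  · rintro M ⟨h1, h2⟩
    exact ⟨ModuleCat.of R PUnit.{w+1}, M, _, _, h1, h2,
      isShortExact_equiv_right (LinearEquiv.refl R M), hz⟩
  · rintro M ⟨h1, h2⟩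
    exact ⟨M, ModuleCat.of R PUnit.{w+1}, _, _, h1, h2,
      isShortExact_equiv_left (LinearEquiv.refl R M), hz⟩

/-- It suffices to find presentations and copresentations up to extension closure. -/
theorem extClosure_le_gorensteinProjective {𝒳 : ObjectProperty (ModuleCat.{w} R)}
    (hext : 𝒳 ≤ ExtOneVanishes) (hpres : 𝒳 ≤ HasPresentation (ExtClosure 𝒳))
    (hcopres : 𝒳 ≤ HasCopresentation (ExtClosure 𝒳)) :
    ExtClosure 𝒳 ≤ gorensteinProjective R := by
  have key : ∀ M, ExtClosure 𝒳 M → ExtOneVanishes M ∧ HasPresentation (ExtClosure 𝒳) M ∧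
      HasCopresentation (ExtClosure 𝒳) M := by
    intro M hM
    induction hM with
    | zero M =>
      have hM : Module.Finite R M ∧ Module.Projective R M := ⟨inferInstance, inferInstance⟩
      exact ⟨.of_projective M, ⟨M, M, _, _, hM.1, hM.2,
        isShortExact_equiv_right (LinearEquiv.refl R M), .zero M⟩, ⟨M, M, _, _, hM.1, hM.2,
        isShortExact_equiv_left (LinearEquiv.refl R M), .zero M⟩⟩
    | step f g h hL hN ih =>
      exact ⟨ih.1.of_isShortExact (hext _ hN) h,
        (isExtClosed_extClosure 𝒳).hasPresentation f g h ih.2.1 (hpres _ hN),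
        (isExtClosed_extClosure 𝒳).hasCopresentation h (hext _ hN) ih.2.2 (hcopres _ hN)⟩
  exact le_gorensteinProjective (fun M hM => (key M hM).1) (fun M hM => (key M hM).2.1)
    (fun M hM => (key M hM).2.2)

/-- Gorenstein projectives have presentations and copresentations among themselves, so the previous
criterion applies with 𝒳 the whole class and absorbs its extension closure. -/
theorem isExtClosed_gorensteinProjective :
    IsExtClosed (gorensteinProjective R : ObjectProperty (ModuleCat.{w} R)) := by
  intro L M N f g h hL hN
  refine extClosure_le_gorensteinProjective gorensteinProjective_extOneVanishes
    (gorensteinProjective_hasPresentation.trans (HasPresentation.mono fun _ => .of))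
    (gorensteinProjective_hasCopresentation.trans (HasCopresentation.mono fun _ => .of)) M
    (isExtClosed_extClosure _ f g h (.of hL) (.of hN))

theorem gorensteinProjective_of_equiv {M N : ModuleCat.{w} R} (h : gorensteinProjective R M)
    (e : M ≃ₗ[R] N) : gorensteinProjective R N :=
  isExtClosed_gorensteinProjective.of_equiv
    (fun M _ => gorensteinProjective_of_projective M) h e

/-- Coinduction on the class of summands. If P → M ⊕ M' has Gorenstein projective kernel K, the
kernel of P → M is an extension of M' by K; adding M to it gives an extension of M' ⊕ M by K, which
is Gorenstein projective. Hence the kernel is again a summand of such a module. Cokernels are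
treated dually. -/
theorem gorensteinProjective_of_prod {M : ModuleCat.{w} R} {M' : Type w} [AddCommGroup M']
    [Module R M'] (h : gorensteinProjective R (ModuleCat.of R (M × M'))) :
    gorensteinProjective R M := by
  refine le_gorensteinProjective
    (𝒲 := fun M => ∃ M' : ModuleCat.{w} R, gorensteinProjective R (ModuleCat.of R (M × M')))
    ?_ ?_ ?_ M ⟨ModuleCat.of R M', h⟩
  · rintro M ⟨M', h⟩
    exact (gorensteinProjective_extOneVanishes _ h).of_prod
  · rintro M ⟨M', h⟩
    obtain ⟨K, P, a, b, h1, h2, h3, h4⟩ := gorensteinProjective_hasPresentation _ h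
    have hfst : IsShortExact (LinearMap.inr R M M') (LinearMap.fst R M M') :=
      ⟨LinearMap.inr_injective, Function.Exact.inr_fst, LinearMap.fst_surjective⟩
    obtain ⟨i, p, hip, -, -⟩ := h3.exists_ker_comp hfst
    refine ⟨ModuleCat.of R (LinearMap.ker (LinearMap.fst R M M' ∘ₗ b)), P, _, _, h1, h2,
      isShortExact_ker (g := LinearMap.fst R M M' ∘ₗ b) (hfst.surjective.comp h3.surjective), M, ?_⟩
    have hid : IsShortExact (0 : PUnit.{w+1} →ₗ[R] M) (LinearMap.id : M →ₗ[R] M) :=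
      isShortExact_equiv_right (LinearEquiv.refl R M)
    have hK : gorensteinProjective R (ModuleCat.of R (K × PUnit.{w+1})) :=
      gorensteinProjective_of_equiv h4 (LinearEquiv.prodUnique (R := R) (M := K)).symm
    exact isExtClosed_gorensteinProjective _ _ (hip.prodMap hid) hK
      (gorensteinProjective_of_equiv (N := ModuleCat.of R (M' × M)) h (LinearEquiv.prodComm R M M'))
  · rintro M ⟨M', h⟩
    obtain ⟨P, C, a, b, h1, h2, h3, h4⟩ := gorensteinProjective_hasCopresentation _ h
    obtain ⟨i, p, hip⟩ := (isShortExact_inl_snd (R := R) (L := M) (M := M')).exists_coker_comp h3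
    refine ⟨P, ModuleCat.of R (P ⧸ LinearMap.range (a ∘ₗ LinearMap.inl R M M')), _, _, h1, h2,
      isShortExact_mkQ_range (f := a ∘ₗ LinearMap.inl R M M')
        (h3.injective.comp LinearMap.inl_injective), M, ?_⟩
    have hid : IsShortExact (LinearMap.id : M →ₗ[R] M) (0 : M →ₗ[R] PUnit.{w+1}) :=
      isShortExact_equiv_left (LinearEquiv.refl R M)
    have hC : gorensteinProjective R (ModuleCat.of R (C × PUnit.{w+1})) :=
      gorensteinProjective_of_equiv h4 (LinearEquiv.prodUnique (R := R) (M := C)).symm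
    exact isExtClosed_gorensteinProjective _ _ (hip.prodMap hid)
      (gorensteinProjective_of_equiv (N := ModuleCat.of R (M' × M)) h
        (LinearEquiv.prodComm R M M')) hC

theorem addFilt_le_gorensteinProjective {𝒳 : ObjectProperty (ModuleCat.{w} R)}
    (h : ExtClosure 𝒳 ≤ gorensteinProjective R) : addFilt 𝒳 ≤ gorensteinProjective R := by
  rintro M ⟨N, M', hN, ⟨e⟩⟩
  exact gorensteinProjective_of_prod (M' := M')
    (gorensteinProjective_of_equiv (h _ hN.extClosure) e)

end GorensteinProjective

/-! ### Tensor products of modules, of maps and of linear forms. -/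

section TensorObj

open scoped ModuleCat

variable (k : Type t) {A : Type v} {B : Type w} [Field k] [Ring A] [Algebra k A] [Ring B]
  [Algebra k B]

/-- The pure tensor `x ⊗ y` as an element of the `A ⊗ B`-module `X ⊗ Y`. -/
noncomputable def tensorObjTmul {X : ModuleCat.{v} A} {Y : ModuleCat.{w} B} (x : X) (y : Y) :
    tensorObj k X Y :=
  (x ⊗ₜ[k] y : X ⊗[k] Y)

theorem smul_tensorObjTmul {X : ModuleCat.{v} A} {Y : ModuleCat.{w} B} (a : A) (b : B) (x : X)
    (y : Y) : (a ⊗ₜ[k] b : A ⊗[k] B) • tensorObjTmul k x y = tensorObjTmul k (a • x) (b • y) :=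
  rfl

theorem tensorObjTmul_zero {X : ModuleCat.{v} A} {Y : ModuleCat.{w} B} (x : X) :
    tensorObjTmul k x (0 : Y) = 0 :=
  TensorProduct.tmul_zero Y x

theorem zero_tensorObjTmul {X : ModuleCat.{v} A} {Y : ModuleCat.{w} B} (y : Y) :
    tensorObjTmul k (0 : X) y = 0 :=
  TensorProduct.zero_tmul X y

theorem tensorObjTmul_add {X : ModuleCat.{v} A} {Y : ModuleCat.{w} B} (x : X) (y y' : Y) :
    tensorObjTmul k x (y + y') = tensorObjTmul k x y + tensorObjTmul k x y' :=
  TensorProduct.tmul_add x y y'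

theorem add_tensorObjTmul {X : ModuleCat.{v} A} {Y : ModuleCat.{w} B} (x x' : X) (y : Y) :
    tensorObjTmul k (x + x') y = tensorObjTmul k x y + tensorObjTmul k x' y :=
  TensorProduct.add_tmul x x' y

variable {k}

theorem tensorObj_induction {X : ModuleCat.{v} A} {Y : ModuleCat.{w} B}
    {p : tensorObj k X Y → Prop} (z : tensorObj k X Y) (zero : p 0)
    (tmul : ∀ x y, p (tensorObjTmul k x y)) (add : ∀ a b, p a → p b → p (a + b)) : p z :=
  TensorProduct.induction_on (motive := p) z zero tmul add

/-- An additive map on `X ⊗ Y` which is compatible with the actions of pure tensors on pure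
tensors is `A ⊗ B`-linear. -/
noncomputable def tensorObjLift {X : ModuleCat.{v} A} {Y : ModuleCat.{w} B} {L : Type*}
    [AddCommGroup L] [Module (A ⊗[k] B) L] (F : X ⊗[k] Y →+ L)
    (hF : ∀ (a : A) (b : B) (x : X) (y : Y),
      F ((a • x) ⊗ₜ (b • y)) = (a ⊗ₜ[k] b : A ⊗[k] B) • F (x ⊗ₜ y)) :
    tensorObj k X Y →ₗ[A ⊗[k] B] L where
  toFun := F
  map_add' := map_add F
  map_smul' r z := by
    rw [RingHom.id_apply]
    induction r using TensorProduct.induction_on with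
    | zero => rw [zero_smul, zero_smul]; exact map_zero F
    | add r s hr hs => rw [add_smul, add_smul, ← hr, ← hs]; exact map_add F _ _
    | tmul a b =>
      induction z using tensorObj_induction with
      | zero => rw [smul_zero]; exact (map_zero F).trans ((congrArg _ (map_zero F)).trans
          (smul_zero _)).symm
      | tmul x y => exact hF a b x y
      | add z z' hz hz' =>
        rw [smul_add]
        exact (map_add F _ _).trans ((congrArg₂ _ hz hz').trans ((smul_add _ _ _).symm.trans
          (congrArg _ (map_add F z z').symm)))

theorem tensorObj_hom_ext {X : ModuleCat.{v} A} {Y : ModuleCat.{w} B} {L : Type*}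
    [AddCommGroup L] [Module (A ⊗[k] B) L] {f g : tensorObj k X Y →ₗ[A ⊗[k] B] L}
    (h : ∀ x y, f (tensorObjTmul k x y) = g (tensorObjTmul k x y)) : f = g :=
  LinearMap.ext fun z => by
    induction z using tensorObj_induction with
    | zero => rw [map_zero, map_zero]
    | tmul x y => exact h x y
    | add z z' hz hz' => rw [map_add, map_add, hz, hz']

variable (k)

/-- The tensor product of an `A`-linear and a `B`-linear map. -/
noncomputable def tensorObjMap {X X' : ModuleCat.{v} A} {Y Y' : ModuleCat.{w} B}
    (f : X →ₗ[A] X') (g : Y →ₗ[B] Y') : tensorObj k X Y →ₗ[A ⊗[k] B] tensorObj k X' Y' :=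
  tensorObjLift (L := tensorObj k X' Y')
    (TensorProduct.map (f.restrictScalars k) (g.restrictScalars k)).toAddMonoidHom
    fun a b x y => by
      change tensorObjTmul k (f (a • x)) (g (b • y)) = _
      rw [map_smul, map_smul]
      rfl

/-- The tensor product of two linear forms. -/
noncomputable def tensorObjForm {X : ModuleCat.{v} A} {Y : ModuleCat.{w} B}
    (f : X →ₗ[A] A) (g : Y →ₗ[B] B) : tensorObj k X Y →ₗ[A ⊗[k] B] A ⊗[k] B :=
  tensorObjLift
    (TensorProduct.map (f.restrictScalars k) (g.restrictScalars k)).toAddMonoidHom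
    fun a b x y => by simp

theorem tensorObjMap_tmul {X X' : ModuleCat.{v} A} {Y Y' : ModuleCat.{w} B}
    (f : X →ₗ[A] X') (g : Y →ₗ[B] Y') (x : X) (y : Y) :
    tensorObjMap k f g (tensorObjTmul k x y) = tensorObjTmul k (f x) (g y) :=
  rfl

theorem tensorObjForm_tmul {X : ModuleCat.{v} A} {Y : ModuleCat.{w} B}
    (f : X →ₗ[A] A) (g : Y →ₗ[B] B) (x : X) (y : Y) :
    tensorObjForm k f g (tensorObjTmul k x y) = f x ⊗ₜ[k] g y :=
  rfl

theorem IsShortExact.tensorObj_right {L M N : ModuleCat.{v} A} {f : L →ₗ[A] M} {g : M →ₗ[A] N}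
    (h : IsShortExact f g) (Y : ModuleCat.{w} B) :
    IsShortExact (tensorObjMap k f (LinearMap.id : Y →ₗ[B] Y))
      (tensorObjMap k g (LinearMap.id : Y →ₗ[B] Y)) :=
  ⟨Module.Flat.rTensor_preserves_injective_linearMap (M := Y) (f.restrictScalars k) h.injective,
    rTensor_exact (R := k) Y (f := f.restrictScalars k) (g := g.restrictScalars k) h.exact
      h.surjective,
    LinearMap.rTensor_surjective (R := k) Y (g := g.restrictScalars k) h.surjective⟩

theorem IsShortExact.tensorObj_left {L M N : ModuleCat.{w} B} {f : L →ₗ[B] M} {g : M →ₗ[B] N}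
    (h : IsShortExact f g) (X : ModuleCat.{v} A) :
    IsShortExact (tensorObjMap k (LinearMap.id : X →ₗ[A] X) f)
      (tensorObjMap k (LinearMap.id : X →ₗ[A] X) g) :=
  ⟨Module.Flat.lTensor_preserves_injective_linearMap (M := X) (f.restrictScalars k) h.injective,
    lTensor_exact (R := k) X (f := f.restrictScalars k) (g := g.restrictScalars k) h.exact
      h.surjective,
    LinearMap.lTensor_surjective (R := k) X (g := g.restrictScalars k) h.surjective⟩

instance tensorObj_finite (X : ModuleCat.{v} A) (Y : ModuleCat.{w} B) [Module.Finite A X]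
    [Module.Finite B Y] : Module.Finite (A ⊗[k] B) (tensorObj k X Y) := by
  obtain ⟨s, hs⟩ := Module.Finite.fg_top (R := A) (M := X)
  obtain ⟨s', hs'⟩ := Module.Finite.fg_top (R := B) (M := Y)
  classical
  refine ⟨(s ×ˢ s').image fun z => tensorObjTmul k z.1 z.2, ?_⟩
  rw [eq_top_iff]
  intro z _
  set N := Submodule.span (A ⊗[k] B)
    (((s ×ˢ s').image fun z => tensorObjTmul k z.1 z.2 : Finset (tensorObj k X Y)) :
      Set (tensorObj k X Y)) with hN
  have h1 : ∀ x ∈ s, ∀ y, tensorObjTmul k x y ∈ N := fun x hx y => by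
    have hy : y ∈ Submodule.span B (s' : Set Y) := hs' ▸ Submodule.mem_top
    induction hy using Submodule.span_induction with
    | mem y hy =>
      exact Submodule.subset_span (Finset.mem_image_of_mem
        (fun z : X × Y => tensorObjTmul k z.1 z.2) (Finset.mk_mem_product hx hy))
    | zero => rw [tensorObjTmul_zero]; exact N.zero_mem
    | add y y' _ _ hy hy' =>
      rw [tensorObjTmul_add]; exact N.add_mem hy hy'
    | smul b y _ hy =>
      have := N.smul_mem ((1 : A) ⊗ₜ[k] b) hy
      rwa [smul_tensorObjTmul, one_smul] at this
  have h2 : ∀ x y, tensorObjTmul k x y ∈ N := fun x y => by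
    have hx : x ∈ Submodule.span A (s : Set X) := hs ▸ Submodule.mem_top
    induction hx using Submodule.span_induction with
    | mem x hx => exact h1 x hx y
    | zero => rw [zero_tensorObjTmul]; exact N.zero_mem
    | add x x' _ _ hx hx' =>
      rw [add_tensorObjTmul]; exact N.add_mem hx hx'
    | smul a x _ hx =>
      have := N.smul_mem (a ⊗ₜ[k] (1 : B)) hx
      rwa [smul_tensorObjTmul, one_smul] at this
  induction z using tensorObj_induction with
  | zero => exact N.zero_mem
  | tmul x y => exact h2 x y
  | add z z' hz hz' => exact N.add_mem (hz trivial) (hz' trivial)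

/-- Sections of the free covers A^(P) → P and B^(Q) → Q tensor to a section of (A ⊗ B)^(P × Q) → P ⊗
Q. -/
instance tensorObj_projective (P : ModuleCat.{v} A) (Q : ModuleCat.{w} B) [Module.Projective A P]
    [Module.Projective B Q] : Module.Projective (A ⊗[k] B) (tensorObj k P Q) := by
  obtain ⟨σ, hσ⟩ := Module.projective_def'.1 (inferInstance : Module.Projective A P)
  obtain ⟨τ, hτ⟩ := Module.projective_def'.1 (inferInstance : Module.Projective B Q)
  let E := finsuppTensorFinsupp k k A B P Q
  let s : (P × Q →₀ A ⊗[k] B) →ₗ[A ⊗[k] B] tensorObj k P Q :=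
    Finsupp.linearCombination (A ⊗[k] B) fun z : P × Q => tensorObjTmul k z.1 z.2
  have hE : ∀ (a : A) (b : B) (f : P →₀ A) (g : Q →₀ B),
      E ((a • f) ⊗ₜ (b • g)) = (a ⊗ₜ[k] b : A ⊗[k] B) • E (f ⊗ₜ g) := fun a b f g => by
    ext ⟨p, q⟩
    simp [E, finsuppTensorFinsupp_apply]
  have hs : ∀ (f : P →₀ A) (g : Q →₀ B), s (E (f ⊗ₜ g)) =
      tensorObjTmul k (Finsupp.linearCombination A id f) (Finsupp.linearCombination B id g) :=
    fun f g => by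
      induction f using Finsupp.induction_linear with
      | zero =>
        rw [TensorProduct.zero_tmul, map_zero, map_zero, map_zero]
        exact (TensorProduct.zero_tmul P _).symm
      | add f f' hf hf' =>
        rw [TensorProduct.add_tmul, map_add, map_add, map_add, hf, hf']
        exact (TensorProduct.add_tmul _ _ _).symm
      | single p a =>
        induction g using Finsupp.induction_linear with
        | zero =>
          rw [TensorProduct.tmul_zero, map_zero, map_zero, map_zero]
          exact (TensorProduct.tmul_zero Q _).symm
        | add f f' hf hf' =>
          rw [TensorProduct.tmul_add, map_add, map_add, map_add, hf, hf']
          exact (TensorProduct.tmul_add _ _ _).symm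
        | single q b =>
          simp only [E, s, finsuppTensorFinsupp_single, Finsupp.linearCombination_single, id]
          exact smul_tensorObjTmul k a b p q
  refine Module.Projective.of_split (tensorObjLift
    (E.toLinearMap ∘ₗ TensorProduct.map (σ.restrictScalars k) (τ.restrictScalars k)).toAddMonoidHom
    fun a b x y => ?_) s (tensorObj_hom_ext fun x y => ?_)
  · simp only [LinearMap.toAddMonoidHom_coe, LinearMap.comp_apply, TensorProduct.map_tmul,
      LinearMap.restrictScalars_apply, map_smul, LinearEquiv.coe_coe]
    exact hE a b _ _
  · refine (hs (σ x) (τ y)).trans ?_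
    rw [show Finsupp.linearCombination A id (σ x) = x from LinearMap.congr_fun hσ x,
      show Finsupp.linearCombination B id (τ y) = y from LinearMap.congr_fun hτ y]
    rfl

theorem finiteDimensional_linearForm [FiniteDimensional k A] {X : ModuleCat.{v} A}
    [Module.Finite A X] :
    FiniteDimensional k (X →ₗ[A] A) :=
  have : FiniteDimensional k X := Module.Finite.trans A X
  Module.Finite.of_injective (LinearMap.restrictScalarsₗ k A X A k)
    (LinearMap.restrictScalars_injective k)

/-- Every linear form on `X ⊗ Y` is a sum of tensor products of linear forms. -/
theorem exists_eq_sum_tensorObjForm [FiniteDimensional k A] [FiniteDimensional k B]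
    {X : ModuleCat.{v} A} {Y : ModuleCat.{w} B} [Module.Finite B Y]
    (φ : tensorObj k X Y →ₗ[A ⊗[k] B] A ⊗[k] B) :
    ∃ (n : ℕ) (f : Fin n → X →ₗ[A] A) (g : Fin n → Y →ₗ[B] B),
      φ = ∑ j, tensorObjForm k (f j) (g j) := by
  have : FiniteDimensional k (Y →ₗ[B] B) := finiteDimensional_linearForm k
  let e := Module.finBasis k A
  let c := Module.finBasis k (Y →ₗ[B] B)
  let π : ∀ i, A ⊗[k] B →ₗ[k] B := fun i =>
    (TensorProduct.lid k B).toLinearMap ∘ₗ (e.coord i).rTensor B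
  have hπ : ∀ i a b, π i (a ⊗ₜ b) = e.coord i a • b := fun i a b => by simp [π]
  have hπs : ∀ i b z, π i ((1 : A) ⊗ₜ[k] b * z) = b * π i z := fun i b z => by
    induction z using TensorProduct.induction_on with
    | zero => simp
    | tmul a b' => simp [hπ]
    | add z z' hz hz' => rw [mul_add, map_add, hz, hz', map_add, mul_add]
  have hπsum : ∀ z, z = ∑ i, e i ⊗ₜ[k] π i z := fun z => by
    induction z using TensorProduct.induction_on with
    | zero => simp
    | tmul a b =>
      simp only [hπ, ← TensorProduct.smul_tmul]
      rw [← TensorProduct.sum_tmul]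
      congr 1
      exact (e.sum_repr a).symm
    | add z z' hz hz' =>
      simp only [map_add, TensorProduct.tmul_add, Finset.sum_add_distrib, ← hz, ← hz']
  -- `Φ i x` is the coordinate of φ(x ⊗ -) along the basis vector `e i` of A, and it is B-linear.
  -- Collecting its coordinates in the basis `c` of forms on Y gives φ(x ⊗ y) = ∑ h j x ⊗ c j y.
  let Φ : ∀ i, X → Y →ₗ[B] B := fun i x =>
    { toFun := fun y => π i (φ (tensorObjTmul k x y))
      map_add' := fun y y' => by
        rw [tensorObjTmul_add, map_add, map_add]
      map_smul' := fun b y => by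
        rw [RingHom.id_apply, smul_eq_mul, ← hπs, ← smul_eq_mul, ← map_smul, smul_tensorObjTmul,
          one_smul] }
  let h : ∀ j, X → A := fun j x => ∑ i, c.repr (Φ i x) j • e i
  have hφ : ∀ x y, φ (tensorObjTmul k x y) = ∑ j, h j x ⊗ₜ[k] c j y := fun x y => by
    rw [hπsum (φ (tensorObjTmul k x y))]
    simp only [h, TensorProduct.sum_tmul]
    rw [Finset.sum_comm]
    refine Finset.sum_congr rfl fun i _ => ?_
    simp only [TensorProduct.smul_tmul, ← TensorProduct.tmul_sum]
    congr 1
    change Φ i x y = _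
    have hc := LinearMap.congr_fun (c.sum_repr (Φ i x)) y
    rw [← hc, LinearMap.sum_apply]
    rfl
  -- Coordinates in A are only k-linear, so A-linearity of `h j` is not visible from its formula. It
  -- follows because the coefficients in such an expansion are unique.
  have huniq : ∀ a : Fin _ → A, (∀ y, ∑ j, a j ⊗ₜ[k] c j y = 0) → ∀ j, a j = 0 := by
    intro a ha j
    refine e.ext_elem fun i => ?_
    have h0 : ∑ j, e.coord i (a j) • c j = 0 := LinearMap.ext fun y => by
      have := congrArg (π i) (ha y)
      simpa [hπ, LinearMap.sum_apply] using this
    simpa using Fintype.linearIndependent_iff.1 c.linearIndependent _ h0 j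
  refine ⟨_, fun j => { toFun := h j, map_add' := fun x x' => ?_, map_smul' := fun a x => ?_ }, c,
    tensorObj_hom_ext fun x y => ?_⟩
  · rw [← sub_eq_zero]
    refine huniq (fun j => h j (x + x') - (h j x + h j x')) (fun y => ?_) j
    simp only [TensorProduct.sub_tmul, TensorProduct.add_tmul, Finset.sum_sub_distrib,
      Finset.sum_add_distrib, ← hφ]
    rw [sub_eq_zero, ← map_add, add_tensorObjTmul]
  · rw [RingHom.id_apply, ← sub_eq_zero]
    refine huniq (fun j => h j (a • x) - a • h j x) (fun y => ?_) j
    have h1 : ∑ j, (a • h j x) ⊗ₜ[k] c j y = (a ⊗ₜ[k] 1 : A ⊗[k] B) * ∑ j, h j x ⊗ₜ[k] c j y := by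
      simp [Finset.mul_sum]
    simp only [TensorProduct.sub_tmul, Finset.sum_sub_distrib]
    rw [h1, ← hφ, ← hφ, ← smul_eq_mul, ← map_smul, smul_tensorObjTmul, one_smul, sub_self]
  · rw [hφ, LinearMap.sum_apply]
    rfl

theorem tensorObjMap_exists_extend [FiniteDimensional k A] [FiniteDimensional k B]
    {X X' : ModuleCat.{v} A} {Y Y' : ModuleCat.{w} B} [Module.Finite B Y]
    {f : X →ₗ[A] X'} (hf : ∀ φ : X →ₗ[A] A, ∃ ψ : X' →ₗ[A] A, ψ ∘ₗ f = φ)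
    {g : Y →ₗ[B] Y'} (hg : ∀ φ : Y →ₗ[B] B, ∃ ψ : Y' →ₗ[B] B, ψ ∘ₗ g = φ)
    (φ : tensorObj k X Y →ₗ[A ⊗[k] B] A ⊗[k] B) :
    ∃ ψ : tensorObj k X' Y' →ₗ[A ⊗[k] B] A ⊗[k] B, ψ ∘ₗ tensorObjMap k f g = φ := by
  obtain ⟨n, a, b, rfl⟩ := exists_eq_sum_tensorObjForm k φ
  choose a' ha' using fun j => hf (a j)
  choose b' hb' using fun j => hg (b j)
  refine ⟨∑ j, tensorObjForm k (a' j) (b' j), tensorObj_hom_ext fun x y => ?_⟩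
  rw [LinearMap.comp_apply, tensorObjMap_tmul, LinearMap.sum_apply, LinearMap.sum_apply]
  refine Finset.sum_congr rfl fun j _ => ?_
  rw [tensorObjForm_tmul, tensorObjForm_tmul, ← ha', ← hb']
  rfl

end TensorObj

/-! ### Tensor products of Gorenstein projective modules. -/

section TensorGorensteinProjective

variable (k : Type t) {A : Type v} {B : Type w} [Field k] [Ring A] [Algebra k A] [Ring B]
  [Algebra k B]

/-- P ⊗ Q → X ⊗ Y factors through X ⊗ Q, so its kernel is an extension of X ⊗ K' by K ⊗ Q. -/
theorem IsExtClosed.hasPresentation_tensorObj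
    {𝒲 : ObjectProperty (ModuleCat.{max v w} (A ⊗[k] B))} (h𝒲 : IsExtClosed 𝒲)
    {K P X : ModuleCat.{v} A} {f : K →ₗ[A] P} {g : P →ₗ[A] X} (h : IsShortExact f g)
    {K' Q Y : ModuleCat.{w} B} {f' : K' →ₗ[B] Q} {g' : Q →ₗ[B] Y} (h' : IsShortExact f' g')
    [Module.Finite A P] [Module.Projective A P] [Module.Finite B Q] [Module.Projective B Q]
    (h₁ : 𝒲 (tensorObj k K Q)) (h₂ : 𝒲 (tensorObj k X K')) :
    HasPresentation 𝒲 (tensorObj k X Y) := by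
  have e₁ := h.tensorObj_right k Q
  have e₂ := h'.tensorObj_left k X
  obtain ⟨i, p, hip, -, -⟩ := e₁.exists_ker_comp e₂
  exact ⟨ModuleCat.of _ (LinearMap.ker (tensorObjMap k (LinearMap.id : X →ₗ[A] X) g' ∘ₗ
      tensorObjMap k g (LinearMap.id : Q →ₗ[B] Q))), tensorObj k P Q, _, _, inferInstance,
    inferInstance, isShortExact_ker (e₂.surjective.comp e₁.surjective), h𝒲 i p hip h₁ h₂⟩

/-- The same map factored through P ⊗ Y: its kernel is also an extension of K ⊗ Y by P ⊗ K'. Which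
filtration is useful depends on which factor has the smaller Ext bound. -/
theorem IsExtClosed.hasPresentation_tensorObj'
    {𝒲 : ObjectProperty (ModuleCat.{max v w} (A ⊗[k] B))} (h𝒲 : IsExtClosed 𝒲)
    {K P X : ModuleCat.{v} A} {f : K →ₗ[A] P} {g : P →ₗ[A] X} (h : IsShortExact f g)
    {K' Q Y : ModuleCat.{w} B} {f' : K' →ₗ[B] Q} {g' : Q →ₗ[B] Y} (h' : IsShortExact f' g')
    [Module.Finite A P] [Module.Projective A P] [Module.Finite B Q] [Module.Projective B Q]
    (h₁ : 𝒲 (tensorObj k P K')) (h₂ : 𝒲 (tensorObj k K Y)) :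
    HasPresentation 𝒲 (tensorObj k X Y) := by
  have e₁ := h'.tensorObj_left k P
  have e₂ := h.tensorObj_right k Y
  obtain ⟨i, p, hip, -, -⟩ := e₁.exists_ker_comp e₂
  exact ⟨ModuleCat.of _ (LinearMap.ker (tensorObjMap k g (LinearMap.id : Y →ₗ[B] Y) ∘ₗ
      tensorObjMap k (LinearMap.id : P →ₗ[A] P) g')), tensorObj k P Q, _, _, inferInstance,
    inferInstance, isShortExact_ker (e₂.surjective.comp e₁.surjective), h𝒲 i p hip h₁ h₂⟩

theorem IsExtClosed.hasCopresentation_tensorObj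
    {𝒲 : ObjectProperty (ModuleCat.{max v w} (A ⊗[k] B))} (h𝒲 : IsExtClosed 𝒲)
    {C P X : ModuleCat.{v} A} {f : X →ₗ[A] P} {g : P →ₗ[A] C} (h : IsShortExact f g)
    {C' Q Y : ModuleCat.{w} B} {f' : Y →ₗ[B] Q} {g' : Q →ₗ[B] C'} (h' : IsShortExact f' g')
    [Module.Finite A P] [Module.Projective A P] [Module.Finite B Q] [Module.Projective B Q]
    (h₁ : 𝒲 (tensorObj k C Y)) (h₂ : 𝒲 (tensorObj k P C')) :
    HasCopresentation 𝒲 (tensorObj k X Y) := by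
  have e₁ := h.tensorObj_right k Y
  have e₂ := h'.tensorObj_left k P
  obtain ⟨i, p, hip⟩ := e₁.exists_coker_comp e₂
  exact ⟨tensorObj k P Q, ModuleCat.of _ (tensorObj k P Q ⧸ LinearMap.range
      (tensorObjMap k (LinearMap.id : P →ₗ[A] P) f' ∘ₗ
        tensorObjMap k f (LinearMap.id : Y →ₗ[B] Y))), _, _, inferInstance,
    inferInstance, isShortExact_mkQ_range (e₂.injective.comp e₁.injective), h𝒲 i p hip h₁ h₂⟩

/-- By the criterion for one presentation, forms need only be extended from the kernel of P ⊗ Q → X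
⊗ Q → X ⊗ Y, and this can be done along each map separately. Forms on K ⊗ Q and on X ⊗ K' are sums
of tensor products, so they extend factor by factor. -/
theorem ExtOneVanishes.tensorObj [FiniteDimensional k A] [FiniteDimensional k B]
    {K P X : ModuleCat.{v} A} {f : K →ₗ[A] P} {g : P →ₗ[A] X} (h : IsShortExact f g)
    {K' Q Y : ModuleCat.{w} B} {f' : K' →ₗ[B] Q} {g' : Q →ₗ[B] Y} (h' : IsShortExact f' g')
    [Module.Projective A P] [Module.Finite B K'] [Module.Finite B Q] [Module.Projective B Q]
    (hX : ExtOneVanishes X) (hY : ExtOneVanishes Y) : ExtOneVanishes (tensorObj k X Y) := by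
  have e₁ := h.tensorObj_right k Q
  have e₂ := h'.tensorObj_left k X
  refine .of_presentation (P := _root_.tensorObj k P Q) (isShortExact_ker
    (g := tensorObjMap k (LinearMap.id : X →ₗ[A] X) g' ∘ₗ
      tensorObjMap k g (LinearMap.id : Q →ₗ[B] Q))
    (e₂.surjective.comp e₁.surjective)) (e₁.exists_extend_ker_comp e₂ ?_ ?_)
  · exact tensorObjMap_exists_extend k (hX f g h) fun φ => ⟨φ, rfl⟩
  · exact tensorObjMap_exists_extend k (fun φ => ⟨φ, rfl⟩) (hY f' g' h')

theorem tensorClass_tensorObj {𝒳 : ObjectProperty (ModuleCat.{v} A)}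
    {𝒴 : ObjectProperty (ModuleCat.{w} B)} {X : ModuleCat.{v} A} {Y : ModuleCat.{w} B}
    (hX : 𝒳 X) (hY : 𝒴 Y) : tensorClass k 𝒳 𝒴 (tensorObj k X Y) :=
  ⟨X, Y, hX, hY, ⟨Iso.refl _⟩⟩

theorem tensorClass_of_equiv {𝒳 : ObjectProperty (ModuleCat.{v} A)}
    {𝒴 : ObjectProperty (ModuleCat.{w} B)} {M N : ModuleCat.{max v w} (A ⊗[k] B)}
    (e : M ≃ₗ[A ⊗[k] B] N) (h : tensorClass k 𝒳 𝒴 M) : tensorClass k 𝒳 𝒴 N := by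
  obtain ⟨X, Y, hX, hY, ⟨i⟩⟩ := h
  exact ⟨X, Y, hX, hY, ⟨e.symm.toModuleIso ≪≫ i⟩⟩

theorem HasPresentation.of_equiv {R : Type u} [Ring R] {𝒲 : ObjectProperty (ModuleCat.{v} R)}
    {M N : ModuleCat.{v} R} (h : HasPresentation 𝒲 M) (e : M ≃ₗ[R] N) : HasPresentation 𝒲 N := by
  obtain ⟨K, P, a, b, h1, h2, h3, h4⟩ := h
  exact ⟨K, P, a, e.toLinearMap ∘ₗ b, h1, h2, ⟨h3.injective, fun x => by simp [← h3.exact x],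
    e.surjective.comp h3.surjective⟩, h4⟩

theorem HasCopresentation.of_equiv {R : Type u} [Ring R] {𝒲 : ObjectProperty (ModuleCat.{v} R)}
    {M N : ModuleCat.{v} R} (h : HasCopresentation 𝒲 M) (e : N ≃ₗ[R] M) :
    HasCopresentation 𝒲 N := by
  obtain ⟨P, C, a, b, h1, h2, h3, h4⟩ := h
  refine ⟨P, C, a ∘ₗ e.toLinearMap, b, h1, h2, ⟨h3.injective.comp e.injective, fun x => ?_,
    h3.surjective⟩, h4⟩
  rw [h3.exact]
  exact (e.surjective.range_comp _).symm ▸ Iff.rfl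

/-- The kernels and cokernels obtained from tensor products are merely extensions of tensor
products, which is why (co)presentations are sought in the extension closure. -/
theorem extClosure_tensorClass_le_gorensteinProjective [FiniteDimensional k A]
    [FiniteDimensional k B] :
    ExtClosure (tensorClass k (gorensteinProjective A) (gorensteinProjective B)) ≤
      (gorensteinProjective (A ⊗[k] B) : ObjectProperty (ModuleCat.{max v w} (A ⊗[k] B))) := by
  refine extClosure_le_gorensteinProjective ?_ ?_ ?_
  · rintro M ⟨X, Y, hX, hY, ⟨i⟩⟩
    obtain ⟨K, P, a, b, _, _, h, hK⟩ := gorensteinProjective_hasPresentation X hX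
    obtain ⟨K', Q, a', b', _, _, h', hK'⟩ := gorensteinProjective_hasPresentation Y hY
    have := gorensteinProjective_finite hK'
    exact (ExtOneVanishes.tensorObj k h h' (gorensteinProjective_extOneVanishes X hX)
      (gorensteinProjective_extOneVanishes Y hY)).of_equiv i.symm.toLinearEquiv
  · rintro M ⟨X, Y, hX, hY, ⟨i⟩⟩
    obtain ⟨K, P, a, b, _, _, h, hK⟩ := gorensteinProjective_hasPresentation X hX
    obtain ⟨K', Q, a', b', _, _, h', hK'⟩ := gorensteinProjective_hasPresentation Y hY
    exact ((isExtClosed_extClosure _).hasPresentation_tensorObj k h h'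
      (.of (tensorClass_tensorObj k hK (gorensteinProjective_of_projective Q)))
      (.of (tensorClass_tensorObj k hX hK'))).of_equiv i.symm.toLinearEquiv
  · rintro M ⟨X, Y, hX, hY, ⟨i⟩⟩
    obtain ⟨P, C, a, b, _, _, h, hC⟩ := gorensteinProjective_hasCopresentation X hX
    obtain ⟨Q, C', a', b', _, _, h', hC'⟩ := gorensteinProjective_hasCopresentation Y hY
    exact ((isExtClosed_extClosure _).hasCopresentation_tensorObj k h h'
      (.of (tensorClass_tensorObj k hC hY))
      (.of (tensorClass_tensorObj k (gorensteinProjective_of_projective P) hC'))).of_equiv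
        i.toLinearEquiv

end TensorGorensteinProjective

/-! ### Dimension shifting for higher Ext. -/

section ExtVanishing

open Abelian

variable {R : Type v} [Ring R]

theorem IsShortExact.shortExact {L M N : ModuleCat.{v} R} {f : L →ₗ[R] M} {g : M →ₗ[R] N}
    (h : IsShortExact f g) :
    (ShortComplex.mk (ModuleCat.ofHom f) (ModuleCat.ofHom g)
      (ModuleCat.hom_ext h.exact.linearMap_comp_eq_zero)).ShortExact where
  exact := (ShortComplex.ShortExact.moduleCat_exact_iff_function_exact _).2 h.exact
  mono_f := (ModuleCat.mono_iff_injective _).2 h.injective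
  epi_g := (ModuleCat.epi_iff_surjective _).2 h.surjective

/-- `Extⁱ(M, T) = 0` for all `i > n`. -/
def ExtVanishesAbove (T : ModuleCat.{v} R) (n : ℕ) (M : ModuleCat.{v} R) : Prop :=
  ∀ i, n < i → ∀ e : Ext M T i, e = 0

variable {T : ModuleCat.{v} R}

theorem ExtVanishesAbove.mono {n m : ℕ} {M : ModuleCat.{v} R} (h : ExtVanishesAbove T n M)
    (hnm : n ≤ m) : ExtVanishesAbove T m M :=
  fun i hi => h i (hnm.trans_lt hi)

theorem ExtVanishesAbove.of_projective (n : ℕ) (P : ModuleCat.{v} R) [Module.Projective R P] :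
    ExtVanishesAbove T n P := fun _ hi e => by
  have : Projective P := ModuleCat.projective_of_categoryTheory_projective P
  obtain ⟨i, rfl⟩ := Nat.exists_eq_succ_of_ne_zero (Nat.ne_of_gt (Nat.zero_lt_of_lt hi))
  exact e.eq_zero_of_projective

theorem IsShortExact.ext_eq_zero_of_projective {K P M : ModuleCat.{v} R} [Module.Projective R P]
    {f : K →ₗ[R] P} {g : P →ₗ[R] M} (h : IsShortExact f g) {i : ℕ} (hi : 0 < i)
    (hM : ∀ e : Ext M T (i + 1), e = 0) (e : Ext K T i) : e = 0 := by
  obtain ⟨e', rfl⟩ := Ext.contravariant_sequence_exact₁ h.shortExact T e (add_comm 1 i) (hM _)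
  rw [ExtVanishesAbove.of_projective 0 P i hi e', Ext.comp_zero]

theorem ExtVanishesAbove.kernel_succ {n : ℕ} {K P M : ModuleCat.{v} R} [Module.Projective R P]
    {f : K →ₗ[R] P} {g : P →ₗ[R] M} (h : IsShortExact f g) (hM : ExtVanishesAbove T (n + 1) M) :
    ExtVanishesAbove T n K := fun _ hi =>
  h.ext_eq_zero_of_projective (Nat.zero_lt_of_lt hi) (hM _ (Nat.succ_lt_succ hi))

theorem ExtVanishesAbove.kernel {n : ℕ} {K P M : ModuleCat.{v} R} [Module.Projective R P]
    {f : K →ₗ[R] P} {g : P →ₗ[R] M} (h : IsShortExact f g) (hM : ExtVanishesAbove T n M) :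
    ExtVanishesAbove T n K :=
  kernel_succ h (hM.mono n.le_succ)

theorem IsShortExact.exists_extend_of_ext {L M N : ModuleCat.{v} R}
    {f : L →ₗ[R] M} {g : M →ₗ[R] N} (h : IsShortExact f g) (hN : ∀ e : Ext N T 1, e = 0)
    (φ : L →ₗ[R] T) : ∃ ψ : M →ₗ[R] T, ψ ∘ₗ f = φ := by
  obtain ⟨x, hx⟩ := Ext.contravariant_sequence_exact₁ h.shortExact T
    (Ext.mk₀ (ModuleCat.ofHom φ)) (add_zero 1) (hN _)
  obtain ⟨ψ, rfl⟩ := Ext.homEquiv₀.symm.surjective x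
  refine ⟨ψ.hom, ?_⟩
  have h' : ModuleCat.ofHom f ≫ ψ = ModuleCat.ofHom φ :=
    Ext.homEquiv₀.symm.injective (by simpa using hx)
  exact congrArg ModuleCat.Hom.hom h'

theorem ExtVanishesAbove.extOneVanishes {M : ModuleCat.{v} R}
    (h : ExtVanishesAbove (ModuleCat.of R R) 0 M) : ExtOneVanishes M :=
  fun _ _ _ _ hfg φ => hfg.exists_extend_of_ext (T := ModuleCat.of R R) (h 1 one_pos) φ

/-- Degrees above 1 are dimension shifting. In degree 1 a class on C comes from a map M → T, and is
zero because that map extends to P. -/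
theorem ExtVanishesAbove.cokernel {M P C : ModuleCat.{v} R} [Module.Projective R P]
    {f : M →ₗ[R] P} {g : P →ₗ[R] C} (h : IsShortExact f g) (hM : ExtVanishesAbove T 0 M)
    (hext : ∀ φ : M →ₗ[R] T, ∃ ψ : P →ₗ[R] T, ψ ∘ₗ f = φ) : ExtVanishesAbove T 0 C := by
  intro i hi e
  obtain ⟨i, rfl⟩ := Nat.exists_eq_succ_of_ne_zero (Nat.ne_of_gt hi)
  obtain ⟨x, rfl⟩ := Ext.contravariant_sequence_exact₃ h.shortExact T e
    (ExtVanishesAbove.of_projective 0 P _ hi _) (add_comm 1 i)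
  cases i with
  | succ i => rw [hM _ i.succ_pos x, Ext.comp_zero]
  | zero =>
    obtain ⟨φ, rfl⟩ := Ext.homEquiv₀.symm.surjective x
    obtain ⟨ψ, hψ⟩ := hext φ.hom
    have h' : φ = ModuleCat.ofHom f ≫ ModuleCat.ofHom ψ := ModuleCat.hom_ext hψ.symm
    rw [Ext.homEquiv₀_symm_apply, h', ← Ext.mk₀_comp_mk₀]
    exact h.shortExact.extClass_comp_assoc _

theorem exists_extVanishesAbove (h : injectiveDimension T ≠ ⊤) :
    ∃ n, ∀ M, ExtVanishesAbove T n M := by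
  obtain ⟨n, hn⟩ := (injectiveDimension_ne_top_iff T).1 h
  exact ⟨n, fun M i hi e => e.eq_zero_of_hasInjectiveDimensionLT (n + 1) hi⟩

end ExtVanishing

/-! ### Duality between left and right modules. -/

section Dual

variable {R : Type v} [Ring R] {M N : Type*} [AddCommGroup M] [Module R M] [AddCommGroup N]
  [Module R N]

/-- Precomposition with `f`, as a linear map of right modules. -/
def precompLinearForm (f : M →ₗ[R] N) : (N →ₗ[R] R) →ₗ[Rᵐᵒᵖ] (M →ₗ[R] R) where
  toFun φ := φ ∘ₗ f
  map_add' _ _ := rfl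
  map_smul' _ _ := rfl

/-- Evaluation at `x`, as a linear form on a right module. -/
def evalLinearForm (x : M) : (M →ₗ[R] R) →ₗ[Rᵐᵒᵖ] R where
  toFun φ := φ x
  map_add' _ _ := rfl
  map_smul' _ _ := rfl

theorem IsShortExact.precompLinearForm {L : Type*} [AddCommGroup L] [Module R L] {f : L →ₗ[R] M}
    {g : M →ₗ[R] N} (h : IsShortExact f g) (hext : ∀ φ : L →ₗ[R] R, ∃ ψ : M →ₗ[R] R, ψ ∘ₗ f = φ) :
    IsShortExact (precompLinearForm g) (precompLinearForm f) := by
  refine ⟨fun φ ψ hφψ => ?_, fun φ => ⟨fun hφ => ?_, ?_⟩, hext⟩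
  · refine LinearMap.ext fun x => ?_
    obtain ⟨y, rfl⟩ := h.surjective x
    exact LinearMap.congr_fun hφψ y
  · exact h.exists_desc φ (LinearMap.congr_fun hφ)
  · rintro ⟨ψ, rfl⟩
    exact LinearMap.ext fun x => (congrArg ψ (h.apply_apply x)).trans (map_zero ψ)

theorem linearForm_eq_sum {n : ℕ} (φ : (Fin n → R) →ₗ[R] R) :
    φ = ∑ i, MulOpposite.op (φ (Pi.single i 1)) • (LinearMap.proj i : (Fin n → R) →ₗ[R] R) := by
  refine LinearMap.pi_ext' fun i => LinearMap.ext_ring ?_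
  simp [Pi.single_apply]

theorem exists_eq_evalLinearForm {n : ℕ} (Φ : ((Fin n → R) →ₗ[R] R) →ₗ[Rᵐᵒᵖ] R) :
    ∃ x, Φ = evalLinearForm x := by
  refine ⟨fun i => Φ (LinearMap.proj i), LinearMap.ext fun φ => ?_⟩
  rw [linearForm_eq_sum φ, map_sum, map_sum]
  refine Finset.sum_congr rfl fun i _ => ?_
  rw [map_smul, map_smul]
  rfl

instance projective_linearForm_pi (n : ℕ) :
    Module.Projective Rᵐᵒᵖ ((Fin n → R) →ₗ[R] R) := by
  refine Module.Projective.of_split (M := Fin n → Rᵐᵒᵖ)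
    { toFun := fun φ i => MulOpposite.op (φ (Pi.single i 1))
      map_add' := fun _ _ => rfl
      map_smul' := fun _ _ => rfl }
    (Fintype.linearCombination Rᵐᵒᵖ
      fun i => (LinearMap.proj i : (Fin n → R) →ₗ[R] R)) ?_
  refine LinearMap.ext fun φ => ?_
  exact (linearForm_eq_sum φ).symm

end Dual

/-! ### Modules without higher Ext over a Gorenstein algebra. -/

section Gorenstein

open scoped ModuleCat

/-- The finitely generated modules `M` with `Extⁱ(M, R) = 0` for all `i > n`. -/
def ExtBoundedClass (R : Type v) [Ring R] (n : ℕ) : ObjectProperty (ModuleCat.{v} R) :=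
  fun M => Module.Finite R M ∧ ExtVanishesAbove (ModuleCat.of R R) n M

/-- Passing to the kernel lowers the Ext bound by one. The truncated subtraction is intended: at n =
0 the kernel stays in the same class. -/
theorem ExtBoundedClass.exists_free_presentation {R : Type v} [Ring R] [IsNoetherianRing R] {n : ℕ}
    {M : ModuleCat.{v} R} (hM : ExtBoundedClass R n M) :
    ∃ (m : ℕ) (g : (Fin m → R) →ₗ[R] M), Function.Surjective g ∧
      ExtBoundedClass R (n - 1) (ModuleCat.of R (LinearMap.ker g)) := by
  have := hM.1
  obtain ⟨m, g, hg⟩ := Module.Finite.exists_fin' R M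
  have h := isShortExact_ker hg
  refine ⟨m, g, hg, inferInstanceAs (Module.Finite R (LinearMap.ker g)), ?_⟩
  cases n with
  | zero => exact hM.2.kernel (P := ModuleCat.of R (Fin m → R)) h
  | succ n => exact ExtVanishesAbove.kernel_succ (P := ModuleCat.of R (Fin m → R)) h hM.2

/-- Dualizing 0 → K → P → M → 0 keeps it exact and makes M* the kernel of P* → K*, so Extʲ(M*, R)
vanishes once Extʲ⁺¹(K*, R) does. After m repetitions the degree exceeds the injective dimension
bound d. -/
theorem ExtBoundedClass.ext_dual_eq_zero {R : Type v} [Ring R] [IsNoetherianRing R] {d : ℕ}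
    (hd : ∀ N, ExtVanishesAbove (ModuleCat.of Rᵐᵒᵖ R) d N) (m : ℕ) {M : ModuleCat.{v} R}
    (hM : ExtBoundedClass R 0 M) {j : ℕ} (hj : 0 < j) (hjm : d < j + m)
    (e : Abelian.Ext (ModuleCat.of Rᵐᵒᵖ (M →ₗ[R] R)) (ModuleCat.of Rᵐᵒᵖ R) j) : e = 0 := by
  induction m generalizing M j with
  | zero => exact hd _ _ hjm e
  | succ m ih =>
    obtain ⟨n, g, hg, hK⟩ := hM.exists_free_presentation
    have h := (isShortExact_ker hg).precompLinearForm
      (hM.2.extOneVanishes.exists_extend (isShortExact_ker hg))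
    exact IsShortExact.ext_eq_zero_of_projective
      (K := ModuleCat.of Rᵐᵒᵖ (M →ₗ[R] R)) (P := ModuleCat.of Rᵐᵒᵖ ((Fin n → R) →ₗ[R] R))
      (M := ModuleCat.of Rᵐᵒᵖ (LinearMap.ker g →ₗ[R] R)) h hj
      (fun e => ih hK (Nat.succ_pos j) (by omega) e) e

/-- Let P' → P → M be a free presentation and let p ∈ P lift x. If all forms kill x, evaluation at p
vanishes on M* and descends to the dual K* of the kernel. Since Ext¹(K'*, R) = 0 it extends to P'*,
where it is evaluation at some q. Thus p is the image of q, and x = 0. -/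
theorem ExtBoundedClass.eq_zero_of_forall_linearForm {R : Type v} [Ring R] [IsNoetherianRing R]
    (hR : injectiveDimension (ModuleCat.of Rᵐᵒᵖ R) ≠ ⊤) {M : ModuleCat.{v} R}
    (hM : ExtBoundedClass R 0 M) (x : M) (hx : ∀ φ : M →ₗ[R] R, φ x = 0) : x = 0 := by
  obtain ⟨d, hd⟩ := exists_extVanishesAbove hR
  obtain ⟨n, g, hg, hK⟩ := hM.exists_free_presentation
  obtain ⟨n', g', hg', hK'⟩ := hK.exists_free_presentation
  have h := (isShortExact_ker hg).precompLinearForm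
    (hM.2.extOneVanishes.exists_extend (isShortExact_ker hg))
  have h' := (isShortExact_ker hg').precompLinearForm
    (hK.2.extOneVanishes.exists_extend (isShortExact_ker hg'))
  obtain ⟨p, rfl⟩ := hg x
  obtain ⟨Φ, hΦ⟩ := h.exists_desc (evalLinearForm p) hx
  obtain ⟨Ψ, hΨ⟩ := IsShortExact.exists_extend_of_ext
    (L := ModuleCat.of Rᵐᵒᵖ (LinearMap.ker g →ₗ[R] R))
    (M := ModuleCat.of Rᵐᵒᵖ ((Fin n' → R) →ₗ[R] R))
    (N := ModuleCat.of Rᵐᵒᵖ (LinearMap.ker g' →ₗ[R] R)) (T := ModuleCat.of Rᵐᵒᵖ R) h'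
    (ExtBoundedClass.ext_dual_eq_zero hd d hK' one_pos (by omega)) Φ
  obtain ⟨q, rfl⟩ := exists_eq_evalLinearForm Ψ
  have hpq : p = (g' q).1 := funext fun i => by
    have h1 := LinearMap.congr_fun hΦ (LinearMap.proj i)
    rw [← hΨ] at h1
    exact h1.symm
  rw [hpq]
  exact (g' q).2

/-- A basis of Hom(M, A) defines a map from M to a free module along which every form extends. It is
injective since forms separate points, and the extension property kills Ext¹ of its cokernel, which
therefore lies in the same class. -/
theorem extBoundedClass_zero_le_gorensteinProjective (k : Type t) {A : Type v} [Field k] [Ring A]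
    [Algebra k A] [FiniteDimensional k A]
    (hA : injectiveDimension (ModuleCat.of Aᵐᵒᵖ A) ≠ ⊤) :
    ExtBoundedClass A 0 ≤ gorensteinProjective A := by
  have : IsNoetherianRing A := IsNoetherianRing.of_finite k A
  refine le_gorensteinProjective (fun M hM => hM.2.extOneVanishes) (fun M hM => ?_)
    (fun M hM => ?_)
  · obtain ⟨n, g, hg, hK⟩ := hM.exists_free_presentation
    exact ⟨ModuleCat.of A (LinearMap.ker g), ModuleCat.of A (Fin n → A), (LinearMap.ker g).subtype,
      g, inferInstanceAs (Module.Finite A (Fin n → A)),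
      inferInstanceAs (Module.Projective A (Fin n → A)), isShortExact_ker hg, hK⟩
  · have := hM.1
    have := finiteDimensional_linearForm k (X := M)
    let c := Module.finBasis k (M →ₗ[A] A)
    let f : M →ₗ[A] (Fin _ → A) := LinearMap.pi c
    have hext : ∀ φ : M →ₗ[A] A, ∃ ψ : (Fin _ → A) →ₗ[A] A, ψ ∘ₗ f = φ := fun φ => by
      refine ⟨∑ i, c.repr φ i • LinearMap.proj i, ?_⟩
      conv_rhs => rw [← c.sum_repr φ]
      refine LinearMap.ext fun x => ?_
      simp only [LinearMap.comp_apply, LinearMap.sum_apply]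
      rfl
    have hf : Function.Injective f := (injective_iff_map_eq_zero f).2 fun x hx => by
      refine hM.eq_zero_of_forall_linearForm hA x fun φ => ?_
      obtain ⟨ψ, rfl⟩ := hext φ
      rw [LinearMap.comp_apply, hx, map_zero]
    have h := isShortExact_mkQ_range hf
    exact ⟨ModuleCat.of A (Fin _ → A), ModuleCat.of A ((Fin _ → A) ⧸ LinearMap.range f), f,
      (LinearMap.range f).mkQ, inferInstanceAs (Module.Finite A (Fin _ → A)),
      inferInstanceAs (Module.Projective A (Fin _ → A)), h,
      inferInstanceAs (Module.Finite A ((Fin _ → A) ⧸ LinearMap.range f)),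
      hM.2.cokernel (P := ModuleCat.of A (Fin _ → A)) (T := ModuleCat.of A A) h hext⟩

end Gorenstein

/-! ### Tensor products inside modules over A ⊗ B. -/

section SplittingField

/-- If `End_A(S) = k` for a simple module `S`, then linearly independent maps `S → L` have
independent images. -/
theorem eq_zero_of_sum_apply_eq_zero {k A S L : Type*} [Field k] [Ring A] [Algebra k A]
    [AddCommGroup S] [Module k S] [Module A S] [IsScalarTower k A S] [IsSimpleModule A S]
    (hS : Function.Surjective (algebraMap k (Module.End A S)))
    [AddCommGroup L] [Module k L] [Module A L] [IsScalarTower k A L] {n : ℕ}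
    (f : Fin n → S →ₗ[A] L) (hf : LinearIndependent k f) (s : Fin n → S)
    (hs : ∑ j, f j (s j) = 0) : s = 0 := by
  induction n with
  | zero => exact Subsingleton.elim _ _
  | succ n ih =>
    rw [linearIndependent_finSucc] at hf
    let F : (Fin n → S) →ₗ[A] L := ∑ j, Fin.tail f j ∘ₗ LinearMap.proj j
    have hF : ∀ x, F x = ∑ j, Fin.tail f j (x j) := fun x => by
      simp only [F, LinearMap.sum_apply]
      rfl
    have hFinj : Function.Injective F := (injective_iff_map_eq_zero F).2 fun x hx =>
      ih _ hf.1 x (by rw [← hF, hx])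
    rw [Fin.sum_univ_succ] at hs
    rcases eq_bot_or_eq_top ((LinearMap.range F).comap (f 0)) with h | h
    · have h0 : s 0 ∈ (LinearMap.range F).comap (f 0) := by
        refine ⟨-Fin.tail s, ?_⟩
        rw [map_neg, hF]
        exact (eq_neg_of_add_eq_zero_left hs).symm
      rw [h, Submodule.mem_bot] at h0
      rw [h0, map_zero, zero_add] at hs
      have htail := ih _ hf.1 (Fin.tail s) hs
      funext j
      exact Fin.cases h0 (fun i => congrFun htail i) j
    -- S is simple, so otherwise f 0 maps all of S into the sum of the other images and factors
    -- through Sⁿ. The components of S → Sⁿ are scalars by hypothesis, which makes f 0 a combination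
    -- of the other maps.
    · obtain ⟨ψ, hψ⟩ := LinearMap.exists_comp_eq_of_injective hFinj (f 0) fun x =>
        (h ▸ Submodule.mem_top : x ∈ (LinearMap.range F).comap (f 0))
      choose c hc using fun j => hS (LinearMap.proj j ∘ₗ ψ)
      refine absurd ?_ hf.2
      have h0 : f 0 = ∑ j, c j • Fin.tail f j := LinearMap.ext fun x => by
        rw [← hψ, LinearMap.comp_apply, hF, LinearMap.sum_apply]
        refine Finset.sum_congr rfl fun j _ => ?_
        have h1 : ψ x j = c j • x := (LinearMap.congr_fun (hc j) x).symm
        rw [h1, LinearMap.smul_apply, ← algebraMap_smul A, map_smul, algebraMap_smul]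
      rw [h0]
      exact Submodule.sum_mem _ fun j _ => Submodule.smul_mem _ _ (Submodule.subset_span ⟨j, rfl⟩)

open scoped ModuleCat

/-- X is a simple A-submodule S of L, Y is Hom_A(S, L) with B acting on values, and F is evaluation.
Injectivity is the independence of images of linearly independent maps. -/
theorem exists_injective_tensor_of_isSplittingFieldFor (k : Type t) (A : Type v) (B : Type w)
    [Field k] [Ring A] [Algebra k A] [FiniteDimensional k A] [Ring B] [Algebra k B]
    (hA : IsSplittingFieldFor k A) (L : Type u) [AddCommGroup L] [Module k L] [Module A L]
    [Module B L] [IsScalarTower k A L] [IsScalarTower k B L] [SMulCommClass A B L]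
    [FiniteDimensional k L] [Nontrivial L] :
    ∃ (X : ModuleCat.{v} A) (Y : ModuleCat.{w} B) (F : X ⊗[k] Y →ₗ[k] L),
      Module.Finite A X ∧ Module.Finite B Y ∧ Function.Injective F ∧ (∃ z, F z ≠ 0) ∧
        ∀ (a : A) (b : B) (x : X) (y : Y), F ((a • x) ⊗ₜ (b • y)) = b • a • F (x ⊗ₜ y) := by
  have : IsArtinian A L := isArtinian_of_tower k inferInstance
  obtain h | ⟨m, hm, -⟩ := IsAtomic.eq_bot_or_exists_atom_le (⊤ : Submodule A L)
  · exact absurd h top_ne_bot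
  have : IsSimpleModule A m := isSimpleModule_iff_isAtom.2 hm
  -- Replacing the submodule by a quotient of A moves it to the universe of A. Likewise Y below is a
  -- quotient of Bⁿ.
  obtain ⟨S, hSfin, ⟨e⟩⟩ : ∃ S : ModuleCat.{v} A, Module.Finite A S ∧ Nonempty (m ≃ₗ[A] S) := by
    obtain ⟨I, -, e⟩ := isSimpleModule_iff_quot_maximal.1 this
    exact ⟨ModuleCat.of A (A ⧸ I), inferInstanceAs (Module.Finite A (A ⧸ I)), e⟩
  have hS : IsSimpleModule A S := IsSimpleModule.congr e.symm
  have hSk : FiniteDimensional k S := Module.Finite.trans A S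
  let f₀ : S →ₗ[A] L := m.subtype ∘ₗ e.symm.toLinearMap
  have hHom : FiniteDimensional k (S →ₗ[A] L) :=
    Module.Finite.of_injective (LinearMap.restrictScalarsₗ k A S L k)
      (LinearMap.restrictScalars_injective k)
  have : Module.Finite B (S →ₗ[A] L) := Module.Finite.of_restrictScalars_finite k B _
  obtain ⟨Y, ⟨ε⟩⟩ : ∃ Y : ModuleCat.{w} B, Nonempty (Y ≃ₗ[B] (S →ₗ[A] L)) := by
    obtain ⟨n, N, e⟩ := Module.Finite.exists_fin_quot_equiv B (S →ₗ[A] L)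
    exact ⟨ModuleCat.of B ((Fin n → B) ⧸ N), e⟩
  let G : S ⊗[k] (S →ₗ[A] L) →ₗ[k] L := TensorProduct.lift
    (LinearMap.flip (LinearMap.restrictScalarsₗ k A S L k))
  have hG : ∀ s f, G (s ⊗ₜ f) = f s := fun s f => rfl
  let c := Module.finBasis k (S →ₗ[A] L)
  have hrep : ∀ z : S ⊗[k] (S →ₗ[A] L), ∃ s : Fin _ → S, z = ∑ j, s j ⊗ₜ c j := fun z => by
    induction z using TensorProduct.induction_on with
    | zero => exact ⟨0, by simp⟩
    | tmul s f =>
      refine ⟨fun j => c.repr f j • s, ?_⟩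
      simp only [TensorProduct.smul_tmul, ← TensorProduct.tmul_sum, c.sum_repr]
    | add z z' hz hz' =>
      obtain ⟨s, rfl⟩ := hz
      obtain ⟨s', rfl⟩ := hz'
      exact ⟨s + s', by simp [TensorProduct.add_tmul, Finset.sum_add_distrib]⟩
  have hGinj : Function.Injective G := (injective_iff_map_eq_zero G).2 fun z hz => by
    obtain ⟨s, rfl⟩ := hrep z
    rw [map_sum] at hz
    rw [eq_zero_of_sum_apply_eq_zero (hA S).2 c c.linearIndependent s hz]
    simp
  refine ⟨S, Y, G ∘ₗ (ε.toLinearMap.restrictScalars k).lTensor S, hSfin,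
    Module.Finite.equiv ε.symm, ?_, ?_, fun a b x y => ?_⟩
  · exact hGinj.comp (Module.Flat.lTensor_preserves_injective_linearMap
      (ε.toLinearMap.restrictScalars k) ε.injective)
  · obtain ⟨x, hx⟩ : ∃ x, f₀ x ≠ 0 := by
      have := IsSimpleModule.nontrivial A S
      obtain ⟨x, hx⟩ := exists_ne (0 : S)
      exact ⟨x, fun h => hx ((Subtype.val_injective.comp e.symm.injective) (h.trans
        (map_zero f₀).symm))⟩
    refine ⟨x ⊗ₜ ε.symm f₀, ?_⟩
    simpa [hG] using hx
  · simpa [hG] using smul_comm a b (ε y x)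

theorem exists_injective_tensorObj (k : Type t) (A : Type v) (B : Type w)
    [Field k] [Ring A] [Algebra k A] [FiniteDimensional k A] [Ring B] [Algebra k B]
    [FiniteDimensional k B] (hk : IsSplittingFieldFor k A ∨ IsSplittingFieldFor k B)
    (L : ModuleCat.{max v w} (A ⊗[k] B)) [Module.Finite (A ⊗[k] B) L] [Nontrivial L] :
    ∃ (X : ModuleCat.{v} A) (Y : ModuleCat.{w} B) (F : tensorObj k X Y →ₗ[A ⊗[k] B] L),
      Module.Finite A X ∧ Module.Finite B Y ∧ Function.Injective F ∧ ∃ z, F z ≠ 0 := by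
  let : Module A L := Module.compHom L
    (Algebra.TensorProduct.includeLeft : A →ₐ[k] A ⊗[k] B).toRingHom
  let : Module B L := Module.compHom L
    (Algebra.TensorProduct.includeRight : B →ₐ[k] A ⊗[k] B).toRingHom
  have hsA : ∀ (a : A) (x : L), a • x = (a ⊗ₜ[k] (1 : B) : A ⊗[k] B) • x := fun a x => rfl
  have hsB : ∀ (b : B) (x : L), b • x = ((1 : A) ⊗ₜ[k] b : A ⊗[k] B) • x := fun b x => rfl
  have : IsScalarTower k A L := ⟨fun c a x => by
    rw [hsA, hsA, ← TensorProduct.smul_tmul', smul_assoc]⟩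
  have : IsScalarTower k B L := ⟨fun c b x => by
    rw [hsB, hsB, TensorProduct.tmul_smul, smul_assoc]⟩
  have : SMulCommClass A B L := ⟨fun a b x => by simp [hsA, hsB, smul_smul]⟩
  have : SMulCommClass B A L := SMulCommClass.symm A B L
  have hsAB : ∀ (a : A) (b : B) (x : L), (a ⊗ₜ[k] b : A ⊗[k] B) • x = b • a • x :=
    fun a b x => by simp [hsA, hsB, smul_smul]
  have : FiniteDimensional k L := Module.Finite.trans (A ⊗[k] B) L
  rcases hk with hA | hB
  · obtain ⟨X, Y, F, hX, hY, hF, hz, hsF⟩ :=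
      exists_injective_tensor_of_isSplittingFieldFor k A B hA L
    exact ⟨X, Y, tensorObjLift F.toAddMonoidHom fun a b x y => (hsF a b x y).trans
      (hsAB _ _ _).symm, hX, hY, hF, hz⟩
  · obtain ⟨Y, X, F, hY, hX, hF, ⟨z, hz⟩, hsF⟩ :=
      exists_injective_tensor_of_isSplittingFieldFor k B A hB L
    let F' := F ∘ₗ (TensorProduct.comm k X Y).toLinearMap
    exact ⟨X, Y, tensorObjLift F'.toAddMonoidHom fun a b x y => (hsF b a y x).trans
      ((smul_comm a b _).trans (hsAB _ _ _).symm), hX, hY,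
      hF.comp (TensorProduct.comm k X Y).injective, (TensorProduct.comm k X Y).symm z, by
        change F (TensorProduct.comm k X Y ((TensorProduct.comm k X Y).symm z)) ≠ 0
        rwa [LinearEquiv.apply_symm_apply]⟩

end SplittingField

/-! ### Dévissage along submodules. -/

section Devissage

variable {R : Type u} [Ring R]

/-- An extension closed class of modules which contains a nonzero submodule of every nonzero
finitely generated module contains all of these. -/
theorem IsExtClosed.of_exists_submodule [IsNoetherianRing R] {𝒲 : ObjectProperty (ModuleCat.{w} R)}
    (h𝒲 : IsExtClosed 𝒲) (h0 : ∀ M : ModuleCat.{w} R, Subsingleton M → 𝒲 M)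
    (h : ∀ L : ModuleCat.{w} R, Module.Finite R L → Nontrivial L →
      ∃ (M : ModuleCat.{w} R) (f : M →ₗ[R] L), 𝒲 M ∧ Function.Injective f ∧ ∃ z, f z ≠ 0)
    (L : ModuleCat.{w} R) [Module.Finite R L] : 𝒲 L := by
  obtain ⟨N, hN, hmax⟩ := set_has_maximal_iff_noetherian.2 (inferInstanceAs (IsNoetherian R L))
    {N : Submodule R L | 𝒲 (ModuleCat.of R N)}
    ⟨⊥, h0 (ModuleCat.of R (⊥ : Submodule R L))
      (inferInstanceAs (Subsingleton (⊥ : Submodule R L)))⟩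
  by_cases hNtop : N = ⊤
  · subst hNtop
    exact h𝒲.of_equiv h0 hN Submodule.topEquiv
  · have : Nontrivial (L ⧸ N) := Submodule.Quotient.nontrivial_iff.2 hNtop
    obtain ⟨M, f, hM, hf, z, hz⟩ := h (ModuleCat.of R (L ⧸ N))
      (inferInstanceAs (Module.Finite R (L ⧸ N))) this
    -- The preimage of the submodule found in L / N is an extension of M by N, hence lies in 𝒲, and
    -- it strictly contains the maximal N.
    let N' : Submodule R L := (LinearMap.range f).comap N.mkQ
    have hle : N ≤ N' := fun x hx => ⟨0, by
      rw [map_zero]; exact ((Submodule.Quotient.mk_eq_zero N).2 hx).symm⟩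
    obtain ⟨p, hp⟩ := LinearMap.exists_comp_eq_of_injective hf (N.mkQ ∘ₗ N'.subtype) fun x => x.2
    replace hp : ∀ x, f (p x) = N.mkQ x.1 := LinearMap.congr_fun hp
    have hex : IsShortExact (Submodule.inclusion hle) p := by
      refine ⟨Submodule.inclusion_injective hle, fun x => ?_, fun y => ?_⟩
      · rw [← hf.eq_iff, hp, map_zero, Submodule.mkQ_apply, Submodule.Quotient.mk_eq_zero]
        exact ⟨fun hx => ⟨⟨x, hx⟩, rfl⟩, fun ⟨y, hy⟩ => hy ▸ y.2⟩
      · obtain ⟨x, hx⟩ := N.mkQ_surjective (f y)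
        exact ⟨⟨x, y, hx.symm⟩, hf ((hp _).trans hx)⟩
    have hN' : 𝒲 (ModuleCat.of R N') := h𝒲 (L := ModuleCat.of R N) _ p hex hN hM
    obtain ⟨x, hx⟩ := N.mkQ_surjective (f z)
    have hxN' : x ∈ N' := ⟨z, hx.symm⟩
    have hlt : N < N' := lt_of_le_of_ne hle fun heq => hz (by
      rw [← hx, Submodule.mkQ_apply, Submodule.Quotient.mk_eq_zero, heq]
      exact hxN')
    exact absurd hlt (hmax N' hN')

end Devissage

/-! ### Syzygies and stable comparison with Gorenstein projectives. -/

section Syzygies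

variable {R : Type u} [Ring R]

/-- The modules with an `n`-th syzygy in `𝒲`. -/
def HasSyzygy (𝒲 : ObjectProperty (ModuleCat.{w} R)) : ℕ → ObjectProperty (ModuleCat.{w} R)
  | 0 => 𝒲
  | n + 1 => HasPresentation (HasSyzygy 𝒲 n)

theorem IsExtClosed.hasSyzygy {𝒲 : ObjectProperty (ModuleCat.{w} R)} (h : IsExtClosed 𝒲) (n : ℕ) :
    IsExtClosed (HasSyzygy 𝒲 n) := by
  induction n with
  | zero => exact h
  | succ n ih => exact ih.hasPresentation

theorem HasSyzygy.of_subsingleton {𝒲 : ObjectProperty (ModuleCat.{w} R)}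
    (h0 : ∀ M : ModuleCat.{w} R, Subsingleton M → 𝒲 M) (n : ℕ) (M : ModuleCat.{w} R)
    [Subsingleton M] : HasSyzygy 𝒲 n M := by
  induction n with
  | zero => exact h0 M inferInstance
  | succ n ih =>
    exact ⟨M, M, _, _, inferInstance, inferInstance,
      isShortExact_equiv_right (LinearEquiv.refl R M), ih⟩

theorem HasSyzygy.of_projective {𝒲 : ObjectProperty (ModuleCat.{w} R)}
    (h0 : ∀ M : ModuleCat.{w} R, Subsingleton M → 𝒲 M) (n : ℕ) {P : ModuleCat.{w} R}
    [Module.Finite R P] [Module.Projective R P] (hP : 𝒲 P) : HasSyzygy 𝒲 n P := by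
  cases n with
  | zero => exact hP
  | succ n =>
    have : Subsingleton (ModuleCat.of R PUnit.{w+1}) := inferInstanceAs (Subsingleton PUnit)
    exact ⟨ModuleCat.of R PUnit.{w+1}, P, _, _, inferInstance, inferInstance,
      isShortExact_equiv_right (LinearEquiv.refl R P), .of_subsingleton h0 n _⟩

theorem exists_projective_complement (P : Type u) [AddCommGroup P] [Module R P]
    [Module.Finite R P] [Module.Projective R P] :
    ∃ (n : ℕ) (Q : ModuleCat.{u} R), Module.Finite R Q ∧ Module.Projective R Q ∧
      Nonempty ((P × Q) ≃ₗ[R] (Fin n → R)) := by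
  obtain ⟨n, f, hf⟩ := Module.Finite.exists_fin' R P
  have hP : IsShortExact (0 : PUnit.{1} →ₗ[R] P) (LinearMap.id : P →ₗ[R] P) :=
    isShortExact_equiv_right (LinearEquiv.refl R P)
  obtain ⟨e⟩ := (isShortExact_ker hf).nonempty_schanuel hP
  let e' := e.trans (LinearEquiv.uniqueProd (R := R) (M := Fin n → R) (M₂ := PUnit.{1}))
  exact ⟨n, ModuleCat.of R (LinearMap.ker f),
    Module.Finite.of_surjective (LinearMap.fst R _ P ∘ₗ e'.symm.toLinearMap)
      (Prod.fst_surjective.comp e'.symm.surjective),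
    Module.Projective.of_split (e'.toLinearMap ∘ₗ LinearMap.inl R _ P)
      (LinearMap.fst R _ P ∘ₗ e'.symm.toLinearMap) (by ext; simp),
    ⟨(LinearEquiv.prodComm R P (LinearMap.ker f)).trans e'⟩⟩

/-- If all finitely generated modules have an `n`-th syzygy in the class `𝒲`, then Gorenstein
projective modules are stably in `𝒲`. -/
theorem exists_prod_of_gorensteinProjective {𝒲 : ObjectProperty (ModuleCat.{u} R)}
    (h𝒲 : IsExtClosed 𝒲) (h0 : ∀ M : ModuleCat.{u} R, Subsingleton M → 𝒲 M)
    (hfree : ∀ n : ℕ, 𝒲 (ModuleCat.of R (Fin n → R))) (n : ℕ)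
    (h : ∀ M : ModuleCat.{u} R, Module.Finite R M → HasSyzygy 𝒲 n M) (M : ModuleCat.{u} R)
    (hM : gorensteinProjective R M) : ∃ Q : ModuleCat.{u} R, 𝒲 (ModuleCat.of R (M × Q)) := by
  suffices key : ∀ m ≤ n, ∀ M : ModuleCat.{u} R, gorensteinProjective R M →
      ∃ Q : ModuleCat.{u} R, Module.Finite R Q ∧ Module.Projective R Q ∧
        HasSyzygy 𝒲 m (ModuleCat.of R (M × Q)) by
    obtain ⟨Q, -, -, hQ⟩ := key 0 n.zero_le M hM
    exact ⟨Q, hQ⟩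
  intro m hm
  induction hm using Nat.decreasingInduction with
  | self =>
    intro M hM
    have := gorensteinProjective_finite hM
    have hfin : Module.Finite R (M × PUnit.{u+1}) := inferInstance
    exact ⟨ModuleCat.of R PUnit.{u+1}, inferInstanceAs (Module.Finite R PUnit.{u+1}),
      inferInstanceAs (Module.Projective R PUnit.{u+1}), h (ModuleCat.of R (M × PUnit.{u+1})) hfin⟩
  | of_succ m _ ih =>
    intro M hM
    obtain ⟨P, C, a, b, _, _, hab, hC⟩ := gorensteinProjective_hasCopresentation M hM
    obtain ⟨Q, _, _, K, P', f, g, _, _, hfg, hK⟩ := ih C hC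
    have hid : IsShortExact (0 : PUnit.{u+1} →ₗ[R] Q) (LinearMap.id : Q →ₗ[R] Q) :=
      isShortExact_equiv_right (LinearEquiv.refl R Q)
    -- Two presentations of C ⊕ Q: one with kernel K, which has an m-th syzygy in 𝒲, and one by P ⊕
    -- Q with kernel M. Hence K ⊕ (P ⊕ Q) ≅ M ⊕ P'.
    obtain ⟨e⟩ := hfg.nonempty_schanuel (hab.prodMap hid)
    -- Only free modules are known to lie in 𝒲, so P ⊕ Q is first completed to a free module; Q' is
    -- then added to the other side as well.
    obtain ⟨r, Q', _, _, ⟨e'⟩⟩ := exists_projective_complement (R := R) (P × Q)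
    refine ⟨ModuleCat.of R (P' × Q'), inferInstanceAs (Module.Finite R (P' × Q')),
      inferInstanceAs (Module.Projective R (P' × Q')), ?_⟩
    have hF : HasSyzygy 𝒲 m (ModuleCat.of R (Fin r → R)) :=
      have : Module.Finite R (ModuleCat.of R (Fin r → R)) :=
        inferInstanceAs (Module.Finite R (Fin r → R))
      have : Module.Projective R (ModuleCat.of R (Fin r → R)) :=
        inferInstanceAs (Module.Projective R (Fin r → R))
      .of_projective h0 m (hfree r)
    have hKF : HasSyzygy 𝒲 m (ModuleCat.of R (K × (Fin r → R))) :=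
      h𝒲.hasSyzygy m (L := K) (N := ModuleCat.of R (Fin r → R)) _ _ isShortExact_inl_snd hK hF
    refine (h𝒲.hasSyzygy m).of_equiv (fun M _ => .of_subsingleton h0 m M) hKF ?_
    exact ((LinearEquiv.refl R K).prodCongr e'.symm).trans
      ((LinearEquiv.prodAssoc R K (P × Q) Q').symm.trans
        ((e.prodCongr (LinearEquiv.refl R Q')).trans
          ((LinearEquiv.prodAssoc R (M × PUnit.{u+1}) P' Q').trans
            ((LinearEquiv.prodUnique (R := R) (M := M) (M₂ := PUnit.{u+1})).prodCongr
              (LinearEquiv.refl R (P' × Q'))))))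

end Syzygies

/-! ### Syzygies of tensor products over Gorenstein algebras. -/

section Main

open scoped ModuleCat

variable (k : Type t) {A : Type v} {B : Type w} [Field k] [Ring A] [Algebra k A]
  [Ring B] [Algebra k B]

theorem nonempty_tensorObj_self_equiv :
    Nonempty (tensorObj k (ModuleCat.of A A) (ModuleCat.of B B) ≃ₗ[A ⊗[k] B] A ⊗[k] B) := by
  let F := tensorObjForm k (X := ModuleCat.of A A) (Y := ModuleCat.of B B)
    LinearMap.id LinearMap.id
  let G := LinearMap.toSpanSingleton (A ⊗[k] B)
    (tensorObj k (ModuleCat.of A A) (ModuleCat.of B B))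
    (tensorObjTmul k (X := ModuleCat.of A A) (Y := ModuleCat.of B B) 1 1)
  refine ⟨LinearEquiv.ofLinearMap F G (LinearMap.ext_ring ?_) (tensorObj_hom_ext fun x y => ?_)⟩
  · rw [LinearMap.comp_apply, LinearMap.toSpanSingleton_apply, one_smul]
    rfl
  · rw [LinearMap.comp_apply, LinearMap.toSpanSingleton_apply, tensorObjForm_tmul,
      smul_tensorObjTmul]
    exact congrArg₂ (tensorObjTmul k) (mul_one (M := A) x) (mul_one (M := B) y)

theorem extClosure_tensorClass_free (n : ℕ) :
    ExtClosure (tensorClass k (gorensteinProjective A) (gorensteinProjective B))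
      (ModuleCat.of (A ⊗[k] B) (Fin n → A ⊗[k] B)) := by
  have hA : gorensteinProjective A (ModuleCat.of A A) :=
    have : Module.Finite A (ModuleCat.of A A) := inferInstanceAs (Module.Finite A A)
    have : Module.Projective A (ModuleCat.of A A) := inferInstanceAs (Module.Projective A A)
    gorensteinProjective_of_projective _
  have hB : gorensteinProjective B (ModuleCat.of B B) :=
    have : Module.Finite B (ModuleCat.of B B) := inferInstanceAs (Module.Finite B B)
    have : Module.Projective B (ModuleCat.of B B) := inferInstanceAs (Module.Projective B B)
    gorensteinProjective_of_projective _
  induction n with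
  | zero =>
    have : Subsingleton (ModuleCat.of (A ⊗[k] B) (Fin 0 → A ⊗[k] B)) :=
      inferInstanceAs (Subsingleton (Fin 0 → A ⊗[k] B))
    exact .zero _
  | succ n ih =>
    obtain ⟨e⟩ := nonempty_tensorObj_self_equiv k (A := A) (B := B)
    have h1 : ExtClosure (tensorClass k (gorensteinProjective A) (gorensteinProjective B))
        (ModuleCat.of (A ⊗[k] B) (A ⊗[k] B)) :=
      (ExtClosure.of (tensorClass_tensorObj k hA hB)).of_equiv e
    have h2 : ExtClosure (tensorClass k (gorensteinProjective A) (gorensteinProjective B))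
        (ModuleCat.of (A ⊗[k] B) ((A ⊗[k] B) × (Fin n → A ⊗[k] B))) :=
      isExtClosed_extClosure _ _ _ isShortExact_inl_snd h1 ih
    exact h2.of_equiv (Fin.consLinearEquiv (A ⊗[k] B) fun _ => A ⊗[k] B)

variable [FiniteDimensional k A] [FiniteDimensional k B]

/-- The kernel is filtered by P ⊗ K' and K ⊗ Y. In both terms the first factor has bound n and the
second has bound 0, as the induction requires; the other filtration would contain X ⊗ K', where the
bound on X has not dropped. -/
theorem hasSyzygy_tensorObj_of_extBoundedClass (hA : IsGorensteinAlgebra A)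
    (hB : IsGorensteinAlgebra B) {n : ℕ} {X : ModuleCat.{v} A} {Y : ModuleCat.{w} B}
    (hX : ExtBoundedClass A n X) (hY : ExtBoundedClass B 0 Y) :
    HasSyzygy (ExtClosure (tensorClass k (gorensteinProjective A) (gorensteinProjective B))) n
      (tensorObj k X Y) := by
  have : IsNoetherianRing A := IsNoetherianRing.of_finite k A
  have : IsNoetherianRing B := IsNoetherianRing.of_finite k B
  induction n generalizing X Y with
  | zero =>
    exact .of (tensorClass_tensorObj k (extBoundedClass_zero_le_gorensteinProjective k hA.2 X hX)
      (extBoundedClass_zero_le_gorensteinProjective k hB.2 Y hY))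
  | succ n ih =>
    obtain ⟨r, g, hg, hK⟩ := hX.exists_free_presentation
    obtain ⟨s, g', hg', hK'⟩ := hY.exists_free_presentation
    have : Module.Finite A (ModuleCat.of A (Fin r → A)) :=
      inferInstanceAs (Module.Finite A (Fin r → A))
    have : Module.Projective A (ModuleCat.of A (Fin r → A)) :=
      inferInstanceAs (Module.Projective A (Fin r → A))
    have : Module.Finite B (ModuleCat.of B (Fin s → B)) :=
      inferInstanceAs (Module.Finite B (Fin s → B))
    have : Module.Projective B (ModuleCat.of B (Fin s → B)) :=
      inferInstanceAs (Module.Projective B (Fin s → B))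
    exact ((isExtClosed_extClosure _).hasSyzygy n).hasPresentation_tensorObj' k
      (P := ModuleCat.of A (Fin r → A)) (K := ModuleCat.of A (LinearMap.ker g))
      (Q := ModuleCat.of B (Fin s → B)) (K' := ModuleCat.of B (LinearMap.ker g'))
      (isShortExact_ker hg) (isShortExact_ker hg')
      (ih ⟨inferInstance, .of_projective n _⟩ hK') (ih hK hY)

/-- Induction on the bound for Y. The kernel is filtered by K ⊗ Q, covered by the previous case
because Q is projective, and by X ⊗ K', where the bound on the second factor has dropped. -/
theorem hasSyzygy_tensorObj (hA : IsGorensteinAlgebra A) (hB : IsGorensteinAlgebra B) {d : ℕ}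
    (hd : ∀ M, ExtVanishesAbove (ModuleCat.of A A) d M) {n : ℕ} (X : ModuleCat.{v} A)
    [Module.Finite A X] {Y : ModuleCat.{w} B} (hY : ExtBoundedClass B n Y) :
    HasSyzygy (ExtClosure (tensorClass k (gorensteinProjective A) (gorensteinProjective B))) (d + n)
      (tensorObj k X Y) := by
  have : IsNoetherianRing A := IsNoetherianRing.of_finite k A
  have : IsNoetherianRing B := IsNoetherianRing.of_finite k B
  induction n generalizing Y with
  | zero => exact hasSyzygy_tensorObj_of_extBoundedClass k hA hB ⟨inferInstance, hd X⟩ hY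
  | succ n ih =>
    have hX : ExtBoundedClass A d X := ⟨inferInstance, hd X⟩
    obtain ⟨r, g, hg, hK⟩ := hX.exists_free_presentation
    obtain ⟨s, g', hg', hK'⟩ := hY.exists_free_presentation
    have : Module.Finite A (ModuleCat.of A (Fin r → A)) :=
      inferInstanceAs (Module.Finite A (Fin r → A))
    have : Module.Projective A (ModuleCat.of A (Fin r → A)) :=
      inferInstanceAs (Module.Projective A (Fin r → A))
    have : Module.Finite B (ModuleCat.of B (Fin s → B)) :=
      inferInstanceAs (Module.Finite B (Fin s → B))
    have : Module.Projective B (ModuleCat.of B (Fin s → B)) :=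
      inferInstanceAs (Module.Projective B (Fin s → B))
    exact ((isExtClosed_extClosure _).hasSyzygy (d + n)).hasPresentation_tensorObj k
      (P := ModuleCat.of A (Fin r → A)) (K := ModuleCat.of A (LinearMap.ker g))
      (Q := ModuleCat.of B (Fin s → B)) (K' := ModuleCat.of B (LinearMap.ker g'))
      (isShortExact_ker hg) (isShortExact_ker hg')
      (hasSyzygy_tensorObj_of_extBoundedClass k hA hB ⟨hK.1, (hd _).mono (d.le_add_right n)⟩
        ⟨inferInstance, .of_projective 0 _⟩) (ih hK')

/-- The sum of bounds on the left injective dimensions of A and B serves all modules at once. This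
uniformity lets dévissage run inside the extension closed class of modules with such a syzygy. -/
theorem exists_hasSyzygy (hA : IsGorensteinAlgebra A) (hB : IsGorensteinAlgebra B)
    (hk : IsSplittingFieldFor k A ∨ IsSplittingFieldFor k B) :
    ∃ n, ∀ L : ModuleCat.{max v w} (A ⊗[k] B), Module.Finite (A ⊗[k] B) L →
      HasSyzygy (ExtClosure (tensorClass k (gorensteinProjective A) (gorensteinProjective B)))
        n L := by
  obtain ⟨d, hd⟩ := exists_extVanishesAbove hA.1
  obtain ⟨d', hd'⟩ := exists_extVanishesAbove hB.1
  have : IsNoetherianRing (A ⊗[k] B) := IsNoetherianRing.of_finite k _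
  refine ⟨d + d', fun L hL => ((isExtClosed_extClosure _).hasSyzygy (d + d')).of_exists_submodule
    (fun M _ => .of_subsingleton (fun M _ => .zero M) _ M) (fun L _ _ => ?_) L⟩
  obtain ⟨X, Y, F, hX, hY, hF, hz⟩ := exists_injective_tensorObj k A B hk L
  exact ⟨tensorObj k X Y, F, hasSyzygy_tensorObj k hA hB hd X ⟨hY, hd' Y⟩, hF, hz⟩

end Main

theorem mainTheorem3 (k : Type t) (A : Type v) (B : Type w) [Field k]
    [Ring A] [Algebra k A] [FiniteDimensional k A]
    [Ring B] [Algebra k B] [FiniteDimensional k B]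
    (hA : IsGorensteinAlgebra A) (hB : IsGorensteinAlgebra B)
    (hk : IsSplittingFieldFor k A ∨ IsSplittingFieldFor k B) :
    (gorensteinProjective (A ⊗[k] B) : ObjectProperty (ModuleCat.{max v w} (A ⊗[k] B))) =
      addFilt (tensorClass k (gorensteinProjective A) (gorensteinProjective B)) := by
  refine le_antisymm (fun M hM => ?_)
    (addFilt_le_gorensteinProjective (extClosure_tensorClass_le_gorensteinProjective k))
  obtain ⟨n, hn⟩ := exists_hasSyzygy k hA hB hk
  obtain ⟨Q, hQ⟩ := exists_prod_of_gorensteinProjective (isExtClosed_extClosure _)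
    (fun M _ => .zero M) (extClosure_tensorClass_free k) n hn M hM
  exact ⟨ModuleCat.of _ (M × Q), Q,
    filt.of_extClosure (fun _ _ e h => tensorClass_of_equiv k e h) hQ, ⟨LinearEquiv.refl _ _⟩⟩
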